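/- Let $(M,g)$ be a smooth (pseudo-)Riemannian manifold of dimension $2$, with Levi-Civita connection $\nabla$ (also denoted by a comma), curvature tensor $R^m{}_{ijk}$ (sign fixed by $\omega_{i,jk}-\omega_{i,kj}=R^m{}_{ijk}\omega_m$) and scalar curvature $R$, so that $R_{ijkl}=\tfrac R2(g_{ik}g_{jl}-g_{il}g_{jk})$. Let $T_{ijk}$ be a smooth tensor field that is symmetric and trace-free in $(i,j)$, and let $\tau_{ij}$ be a smooth symmetric trace-free tensor field. Put $$t_j=\tfrac12T_{aj}{}^a,\quad Q_{ijk}{}^m=T_{ij}{}^m{}_{,k}+T_{ij}{}^lT_{lk}{}^m-R_{ijk}{}^m+\tau_{ij}\delta_k^m,\quad q_j{}^m=Q_{ij}{}^{im},\quad \Gamma_{ijk}=\tau_{ij,k}+T_{ij}{}^a\tau_{ak},\quad \gamma_k=\Gamma_{ak}{}^a,$$ $$P_{ijkmn}=\tfrac16\,\mathrm{Sym}_{mn}\bigl(\mathrm{Sym}_{ij}\mathrm{Alt}_{jk}\,T_{mji}g_{kn}+g_{ij}(T_{mkn}-2t_mg_{kn})\bigr),\qquad \Lambda_{kab}=\tfrac16\,\mathrm{Sym}_{ab}\,(T_{kab}-2t_ag_{bk}),$$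 where $\mathrm{Sym}$ and $\mathrm{Alt}$ denote the unnormalised (anti)symmetrisations, $\mathrm{Alt}_{jk}$ being applied before $\mathrm{Sym}_{ij}$. Consider the prolongation systems $$V_{,ij}=T_{ij}{}^mV_{,m}+\tau_{ij}V+\tfrac12g_{ij}\Delta V,\qquad (\Delta V)_{,k}=2q_k{}^mV_{,m}+2\gamma_kV+2t_k\Delta V \tag{V}$$ for a function $V$, and $$\nabla_kC_{ij}=P_{ijk}{}^{mn}C_{mn} \tag{C}$$ for a symmetric trace-free tensor field $C$, where $\tau$ is the tensor determined by $T$ through $$\tau_{ij}=\Lambda_{ij}{}^a{}_{,a}-\Lambda^a{}_{ja,i}+\Lambda_{iab}P^{abc}{}_{cj}-\Lambda^{cab}P_{abijc}. \tag{0}$$ By the Ricci identities for (V) we mean $V_{,ijk}-V_{,ikj}=R^m{}_{ijk}V_{,m}$ and $(\Delta V)_{,kl}=(\Delta V)_{,lk}$, and by the Ricci identities for (C) we mean $C_{ij,kl}-C_{ij,lk}=R^m{}_{ikl}C_{mj}+R^m{}_{jkl}C_{im}$; here all derivatives are obtained by differentiating the system and substituting it, and the identities are required at every point, for all values of $(V,V_{,m},\Delta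 V)$, respectively for all symmetric trace-free values of $C$. Then (0) and the Ricci identities for (V) and (C) hold if and only if there is a totally symmetric, trace-free smooth $(0,3)$-tensor field $S$ and, in a neighbourhood of each point, a smooth function $t$ with differential $dt$, whose components are written $t_i$, such that \begin{align*} T_{ijk}&=S_{ijk}+t_ig_{jk}+t_jg_{ik}-g_{ij}t_k,\\ \Delta t&=\tfrac13S^{abc}S_{abc}+\tfrac32R,\\ \bigl(\nabla_lS_{ijk}\bigr)_{\mathrm{sym},\circ}&=\tfrac43\bigl(S_{ijk}t_l\bigr)_{\mathrm{sym},\circ},\\ \tau_{ij}&=\bigl(\tfrac23\nabla^2_{ij}t-\tfrac49S_{ija}t^a-\tfrac89t_it_j+\tfrac13\nabla^aS_{ija}\bigr)_\circ,\\ 0&=\mathrm{Alt}_{kl}\bigl(q_k{}^n{}_{,l}+T_{ml}{}^nq_k{}^m+2t_kq_l{}^n+\gamma_k\delta_l^n\bigr),\\ 0&=\mathrm{Alt}_{ij}\bigl(\gamma_{i,j}+q_i{}^m\tau_{mj}+2t_i\gamma_j\bigr), \end{align*} where $(\cdot)_\circ$ denotes the trace-free part and $(\cdot)_{\mathrm{sym},\circ}$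 the totally symmetric trace-free part. -/

import Mathlib

open scoped Manifold ContDiff

noncomputable section

namespace Superint

/-- The model space `ℝ²` of a surface. -/
abbrev Plane : Type := EuclideanSpace ℝ (Fin 2)

/-! ### Tensor fields on a surface and their components in a local chart -/

section Manifold

variable {M : Type*} [TopologicalSpace M] [ChartedSpace Plane M]

/-- The coordinate vector `∂ᵢ` of the chart `e` at the point with coordinates `y`. -/
def coordVec (e : OpenPartialHomeomorph M Plane) (y : Plane) (i : Fin 2) :
    TangentSpace 𝓘(ℝ, Plane) (e.symm y) :=
  mfderiv 𝓘(ℝ, Plane) 𝓘(ℝ, Plane) e.symm y (EuclideanSpace.single i (1 : ℝ) : Plane)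

/-- The smooth local charts of the surface. -/
abbrev charts (M : Type*) [TopologicalSpace M] [ChartedSpace Plane M] :
    Set (OpenPartialHomeomorph M Plane) :=
  IsManifold.maximalAtlas 𝓘(ℝ, Plane) ∞ M

/-- A smooth covariant tensor field of rank `k`: a multilinear form on each tangent space whose
components in every smooth chart are smooth functions of the coordinates. -/
structure TensorField (M : Type*) [TopologicalSpace M] [ChartedSpace Plane M] (k : ℕ) where
  form : ∀ x : M, MultilinearMap ℝ (fun _ : Fin k => TangentSpace 𝓘(ℝ, Plane) x) ℝ
  smooth : ∀ e ∈ charts M, ∀ i : Fin k → Fin 2,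
    ContDiffOn ℝ ∞ (fun y => form (e.symm y) (fun a => coordVec e y (i a))) e.target

end Manifold

/-- Components of a covariant tensor field of rank `k` as functions of two coordinates:
`A y ![i, j, …]` stands for the component with indices `i, j, …` at the point `y`. -/
abbrev Comp (k : ℕ) : Type := Plane → (Fin k → Fin 2) → ℝ

/-- The components of a tensor field in a chart (meaningful on `e.target`). -/
def TensorField.comp {M : Type*} [TopologicalSpace M] [ChartedSpace Plane M] {k : ℕ}
    (A : TensorField M k) (e : OpenPartialHomeomorph M Plane) : Comp k :=
  fun y i => A.form (e.symm y) (fun a => coordVec e y (i a))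

/-- The tensor field `g` is a (pseudo-)Riemannian metric: symmetric and non-degenerate. -/
def TensorField.IsMetric {M : Type*} [TopologicalSpace M] [ChartedSpace Plane M]
    (g : TensorField M 2) : Prop :=
  (∀ x : M, ∀ u v : TangentSpace 𝓘(ℝ, Plane) x, g.form x ![u, v] = g.form x ![v, u]) ∧
  (∀ x : M, ∀ u : TangentSpace 𝓘(ℝ, Plane) x, (∀ v, g.form x ![u, v] = 0) → u = 0)

/-! ### Tensor calculus in coordinates

Throughout, `g` denotes the components of the metric, all indices of a tensor are lowered, and the
last index of a covariant derivative is the index of differentiation, so that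
`cov g A y ![i, j, k]` is `A_{ij,k} = ∇ₖ A_{ij}`. -/

/-- The partial derivative `∂ᵢ f`. -/
def pd (i : Fin 2) (f : Plane → ℝ) (y : Plane) : ℝ :=
  fderiv ℝ f y (EuclideanSpace.single i (1 : ℝ))

/-- The inverse metric `g^{ij}`. -/
def gInv (g : Comp 2) (y : Plane) (i j : Fin 2) : ℝ :=
  (Matrix.of fun a b : Fin 2 => g y ![a, b])⁻¹ i j

/-- The Christoffel symbols `Γ^m_{ij}` of the Levi-Civita connection. -/
def chris (g : Comp 2) (y : Plane) (m i j : Fin 2) : ℝ :=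
  (1 / 2) * ∑ l, gInv g y m l *
    (pd i (fun z => g z ![j, l]) y + pd j (fun z => g z ![i, l]) y - pd l (fun z => g z ![i, j]) y)

/-- The covariant derivative of a covariant tensor. -/
def cov (g : Comp 2) {k : ℕ} (A : Comp k) : Comp (k + 1) := fun y idx =>
  pd (idx (Fin.last k)) (fun z => A z (fun a => idx a.castSucc)) y
    - ∑ a : Fin k, ∑ m : Fin 2, chris g y m (idx (Fin.last k)) (idx a.castSucc) *
        A y (Function.update (fun b : Fin k => idx b.castSucc) a m)

/-- The curvature tensor `R^m_{ijk}`, with the sign for which the Ricci identity of a 1-form reads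
`ω_{i,jk} - ω_{i,kj} = R^m_{ijk} ω_m`. -/
def riem (g : Comp 2) (y : Plane) (m i j k : Fin 2) : ℝ :=
  pd j (fun z => chris g z m i k) y - pd k (fun z => chris g z m i j) y
    + ∑ n, (chris g y m j n * chris g y n i k - chris g y m k n * chris g y n i j)

/-- The curvature tensor with all indices lowered; on a surface
`R_{ijkl} = (R/2) (g_{ik} g_{jl} - g_{il} g_{jk})`. -/
def riemLow (g : Comp 2) (y : Plane) (i j k l : Fin 2) : ℝ :=
  ∑ n, g y ![i, n] * riem g y n j k l

/-- The scalar curvature `R` (twice the Gauss curvature). -/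
def scal (g : Comp 2) (y : Plane) : ℝ :=
  ∑ i, ∑ k, ∑ m, gInv g y i k * riem g y m i m k

/-- Trace-free part `(X_{ij})_∘` in dimension two. -/
def tfPart (g : Comp 2) (y : Plane) (X : Fin 2 → Fin 2 → ℝ) (i j : Fin 2) : ℝ :=
  X i j - (1 / 2) * g y ![i, j] * ∑ a, ∑ b, gInv g y a b * X a b

/-- The symmetric trace-free projection `X_{ij} + X_{ji} - g_{ij} X^a_a` in dimension two. -/
def symTF2 (g : Comp 2) (y : Plane) (X : Fin 2 → Fin 2 → ℝ) (i j : Fin 2) : ℝ :=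
  X i j + X j i - g y ![i, j] * ∑ a, ∑ b, gInv g y a b * X a b

/-- Complete symmetrisation of a 4-tensor (sum over all permutations of the indices). -/
def sym4 (X : (Fin 4 → Fin 2) → ℝ) (i : Fin 4 → Fin 2) : ℝ :=
  ∑ σ : Equiv.Perm (Fin 4), X (fun a => i (σ a))

/-- Trace of a 4-tensor in its first two indices. -/
def tr4 (g : Comp 2) (y : Plane) (X : (Fin 4 → Fin 2) → ℝ) (k l : Fin 2) : ℝ :=
  ∑ a, ∑ b, gInv g y a b * X ![a, b, k, l]

/-- The totally symmetric trace-free projection of a 4-tensor in dimension two: complete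
symmetrisation, followed by removal of all traces. -/
def symTF4 (g : Comp 2) (y : Plane) (X : (Fin 4 → Fin 2) → ℝ) (i j k l : Fin 2) : ℝ :=
  let Y := sym4 X
  let t2 := tr4 g y Y
  let t0 := ∑ a, ∑ b, gInv g y a b * t2 a b
  Y ![i, j, k, l]
    - (1 / 6) * (g y ![i, j] * t2 k l + g y ![i, k] * t2 j l + g y ![i, l] * t2 j k
        + g y ![j, k] * t2 i l + g y ![j, l] * t2 i k + g y ![k, l] * t2 i j)
    + (1 / 24) * t0 * (g y ![i, j] * g y ![k, l] + g y ![i, k] * g y ![j, l]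
        + g y ![i, l] * g y ![j, k])

/-! ### The structure tensors and the tensors derived from them -/

/-- `t_j = ½ T_{aj}^a`. -/
def tForm (g : Comp 2) (T : Comp 3) : Comp 1 := fun y i =>
  (1 / 2) * ∑ a, ∑ b, gInv g y a b * T y ![a, i 0, b]

/-- `T_{ij}^m`. -/
def Tup (g : Comp 2) (T : Comp 3) (y : Plane) (i j m : Fin 2) : ℝ :=
  ∑ n, gInv g y m n * T y ![i, j, n]

/-- `Q_{ijkm} = T_{ijm,k} + T_{ij}^l T_{lkm} - R_{ijkm} + τ_{ij} g_{km}`. -/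
def Qten (g : Comp 2) (T : Comp 3) (τ : Comp 2) (y : Plane) (i j k m : Fin 2) : ℝ :=
  cov g T y ![i, j, m, k] + ∑ l, Tup g T y i j l * T y ![l, k, m]
    - riemLow g y i j k m + τ y ![i, j] * g y ![k, m]

/-- `q_{jm} = g^{ik} Q_{ijkm}`. -/
def qten (g : Comp 2) (T : Comp 3) (τ : Comp 2) : Comp 2 := fun y idx =>
  ∑ i, ∑ k, gInv g y i k * Qten g T τ y i (idx 0) k (idx 1)

/-- `q_j^m`. -/
def qup (g : Comp 2) (T : Comp 3) (τ : Comp 2) (y : Plane) (j m : Fin 2) : ℝ :=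
  ∑ n, gInv g y m n * qten g T τ y ![j, n]

/-- `Γ_{ijk} = τ_{ij,k} + T_{ij}^a τ_{ak}`. -/
def Gten (g : Comp 2) (T : Comp 3) (τ : Comp 2) (y : Plane) (i j k : Fin 2) : ℝ :=
  cov g τ y ![i, j, k] + ∑ a, Tup g T y i j a * τ y ![a, k]

/-- `γ_k = Γ_{ak}^a`. -/
def gam (g : Comp 2) (T : Comp 3) (τ : Comp 2) : Comp 1 := fun y idx =>
  ∑ a, ∑ c, gInv g y a c * Gten g T τ y a (idx 0) c

/-- `P_{ijkmn} = (1/6) Sym_{mn} ( Sym_{ij} Alt_{jk} T_{mji} g_{kn} + g_{ij} (T_{mkn} - 2 t_m g_{kn}) )`,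
where `Sym` and `Alt` are unnormalised. -/
def Pten (g : Comp 2) (T : Comp 3) : Comp 5 := fun y idx =>
  let t := fun m : Fin 2 => tForm g T y ![m]
  let B := fun i j k m n : Fin 2 => T y ![m, j, i] * g y ![k, n]
  let altB := fun i j k m n : Fin 2 => B i j k m n - B i k j m n
  let A := fun i j k m n : Fin 2 =>
    altB i j k m n + altB j i k m n + g y ![i, j] * (T y ![m, k, n] - 2 * t m * g y ![k, n])
  (1 / 6) * (A (idx 0) (idx 1) (idx 2) (idx 3) (idx 4) + A (idx 0) (idx 1) (idx 2) (idx 4) (idx 3))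

/-- `Λ_{kab} = (1/6) Sym_{ab} (T_{kab} - 2 t_a g_{bk})`. -/
def Lam (g : Comp 2) (T : Comp 3) : Comp 3 := fun y idx =>
  let t := fun m : Fin 2 => tForm g T y ![m]
  let A := fun k a b : Fin 2 => T y ![k, a, b] - 2 * t a * g y ![b, k]
  (1 / 6) * (A (idx 0) (idx 1) (idx 2) + A (idx 0) (idx 2) (idx 1))

/-- `Λ_{ij}^a_{,a} - Λ^a_{ja,i} + Λ_{iab} P^{abc}_{cj} - Λ^{cab} P_{abijc}`. -/
def rawTau (g : Comp 2) (T : Comp 3) (y : Plane) (i j : Fin 2) : ℝ :=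
  (∑ a, ∑ b, gInv g y a b * cov g (Lam g T) y ![i, j, a, b])
    - (∑ a, ∑ b, gInv g y a b * cov g (Lam g T) y ![a, j, b, i])
    + (∑ a, ∑ b, ∑ c, ∑ a', ∑ b', ∑ c', gInv g y a a' * gInv g y b b' * gInv g y c c' *
        Lam g T y ![i, a, b] * Pten g T y ![a', b', c', c, j])
    - (∑ a, ∑ b, ∑ c, ∑ a', ∑ b', ∑ c', gInv g y a a' * gInv g y b b' * gInv g y c c' *
        Lam g T y ![c', a', b'] * Pten g T y ![a, b, i, j, c])

/-! ### Ricci identities of the prolongation system of the potential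

The system is
`V_{,ij} = T_{ij}^m V_{,m} + τ_{ij} V + ½ g_{ij} ΔV`,
`(ΔV)_{,k} = 2 q_k^m V_{,m} + 2 γ_k V + 2 t_k ΔV`.
In what follows `v`, `p`, `L` stand for the values of `V`, `V_{,m}`, `ΔV` at a point; every
derivative of `V`, `V_{,m}`, `ΔV` is replaced by means of the system. -/

/-- The value of `V_{,ij}` prescribed by the system. -/
def hessV (g : Comp 2) (T : Comp 3) (τ : Comp 2) (y : Plane) (v : ℝ) (p : Fin 2 → ℝ) (L : ℝ)
    (i j : Fin 2) : ℝ :=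
  ∑ m, Tup g T y i j m * p m + τ y ![i, j] * v + (1 / 2) * g y ![i, j] * L

/-- The value of `(ΔV)_{,k}` prescribed by the system. -/
def dLapV (g : Comp 2) (T : Comp 3) (τ : Comp 2) (y : Plane) (v : ℝ) (p : Fin 2 → ℝ) (L : ℝ)
    (k : Fin 2) : ℝ :=
  2 * ∑ m, qup g T τ y k m * p m + 2 * gam g T τ y ![k] * v + 2 * tForm g T y ![k] * L

/-- The value of `V_{,ijk}` obtained by differentiating the first equation covariantly and
substituting the system. -/
def thirdV (g : Comp 2) (T : Comp 3) (τ : Comp 2) (y : Plane) (v : ℝ) (p : Fin 2 → ℝ) (L : ℝ)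
    (i j k : Fin 2) : ℝ :=
  ∑ m, ((∑ n, gInv g y m n * cov g T y ![i, j, n, k]) * p m
      + Tup g T y i j m * hessV g T τ y v p L m k)
    + (cov g τ y ![i, j, k] * v + τ y ![i, j] * p k)
    + (1 / 2) * g y ![i, j] * dLapV g T τ y v p L k

/-- The value of `(ΔV)_{,kl}` obtained by differentiating the second equation covariantly and
substituting the system. -/
def hessLapV (g : Comp 2) (T : Comp 3) (τ : Comp 2) (y : Plane) (v : ℝ) (p : Fin 2 → ℝ) (L : ℝ)
    (k l : Fin 2) : ℝ :=
  2 * ∑ m, ((∑ n, gInv g y m n * cov g (qten g T τ) y ![k, n, l]) * p m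
      + qup g T τ y k m * hessV g T τ y v p L m l)
    + 2 * (cov g (gam g T τ) y ![k, l] * v + gam g T τ y ![k] * p l)
    + 2 * (cov g (tForm g T) y ![k, l] * L + tForm g T y ![k] * dLapV g T τ y v p L l)

/-- The Ricci identities (integrability conditions) at `y` of the prolongation system of the
potential: `V_{,ijk} - V_{,ikj} = R^m_{ijk} V_{,m}` and `(ΔV)_{,kl} = (ΔV)_{,lk}`, for all values
of `V`, `V_{,m}`, `ΔV`. -/
def RicciV (g : Comp 2) (T : Comp 3) (τ : Comp 2) (y : Plane) : Prop :=
  ∀ (v : ℝ) (p : Fin 2 → ℝ) (L : ℝ),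
    (∀ i j k, thirdV g T τ y v p L i j k - thirdV g T τ y v p L i k j
      = ∑ m, riem g y m i j k * p m) ∧
    (∀ k l, hessLapV g T τ y v p L k l = hessLapV g T τ y v p L l k)

/-! ### Ricci identities of the prolongation system `∇ₖ C_{ij} = P_{ijk}^{mn} C_{mn}` of the
trace-free conformal Killing tensors; `c` stands for the value of `C` at a point. -/

/-- The value of `C_{ij,k}` prescribed by the system. -/
def dC (g : Comp 2) (T : Comp 3) (y : Plane) (c : Fin 2 → Fin 2 → ℝ) (i j k : Fin 2) : ℝ :=
  ∑ m, ∑ n, (∑ r, ∑ s, gInv g y m r * gInv g y n s * Pten g T y ![i, j, k, r, s]) * c m n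

/-- The value of `C_{ij,kl}` obtained by differentiating the system covariantly and
substituting it. -/
def ddC (g : Comp 2) (T : Comp 3) (y : Plane) (c : Fin 2 → Fin 2 → ℝ) (i j k l : Fin 2) : ℝ :=
  ∑ m, ∑ n,
    ((∑ r, ∑ s, gInv g y m r * gInv g y n s * cov g (Pten g T) y ![i, j, k, r, s, l]) * c m n
      + (∑ r, ∑ s, gInv g y m r * gInv g y n s * Pten g T y ![i, j, k, r, s])
        * dC g T y c m n l)

/-- The Ricci identities (integrability conditions) at `y` of the prolongation system for `C`:
`C_{ij,kl} - C_{ij,lk} = R^m_{ikl} C_{mj} + R^m_{jkl} C_{im}`, for all symmetric trace-free values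
of `C`. -/
def RicciC (g : Comp 2) (T : Comp 3) (y : Plane) : Prop :=
  ∀ c : Fin 2 → Fin 2 → ℝ, (∀ i j, c i j = c j i) → (∑ a, ∑ b, gInv g y a b * c a b = 0) →
    ∀ i j k l, ddC g T y c i j k l - ddC g T y c i j l k
      = ∑ m, (riem g y m i k l * c m j + riem g y m j k l * c i m)

/-! ### The structural conditions; `dt` are the components of the differential of a function `t` -/

/-- The differential of a function of the coordinates. -/
def diffl (f : Plane → ℝ) : Comp 1 := fun y i => pd (i 0) f y

/-- `T_{ijk} = S_{ijk} + (t_i g_{jk} + t_j g_{ik} - g_{ij} t_k)`. -/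
def CondT (g : Comp 2) (T S : Comp 3) (dt : Comp 1) (y : Plane) : Prop :=
  ∀ i j k, T y ![i, j, k] =
    S y ![i, j, k] + symTF2 g y (fun a b => dt y ![a] * g y ![b, k]) i j

/-- `Δt = ⅓ S^{abc} S_{abc} + (3/2) R`. -/
def CondLap (g : Comp 2) (S : Comp 3) (dt : Comp 1) (y : Plane) : Prop :=
  ∑ i, ∑ j, gInv g y i j * cov g dt y ![i, j] =
    (1 / 3) * (∑ a, ∑ b, ∑ c, ∑ a', ∑ b', ∑ c',
      gInv g y a a' * gInv g y b b' * gInv g y c c' * S y ![a, b, c] * S y ![a', b', c'])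
    + (3 / 2) * scal g y

/-- The symmetric trace-free part of `∇S` equals `4/3` of that of `S ⊗ dt`. -/
def CondDS (g : Comp 2) (S : Comp 3) (dt : Comp 1) (y : Plane) : Prop :=
  ∀ i j k l, symTF4 g y (fun I => cov g S y I) i j k l =
    (4 / 3) * symTF4 g y (fun I => S y ![I 0, I 1, I 2] * dt y ![I 3]) i j k l

/-- `τ_{ij} = ( ⅔ ∇²_{ij} t - (4/9) S_{ija} t^a - (8/9) t_i t_j + ⅓ ∇^a S_{ija} )_∘`. -/
def CondTau (g : Comp 2) (S : Comp 3) (dt : Comp 1) (τ : Comp 2) (y : Plane) : Prop :=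
  ∀ i j, τ y ![i, j] = tfPart g y (fun i j =>
    (2 / 3) * cov g dt y ![i, j]
      - (4 / 9) * (∑ a, ∑ b, gInv g y a b * S y ![i, j, a] * dt y ![b])
      - (8 / 9) * dt y ![i] * dt y ![j]
      + (1 / 3) * ∑ a, ∑ b, gInv g y a b * cov g S y ![i, j, a, b]) i j

/-- `0 = Alt_{kl} ( q_k^n_{,l} + T_{ml}^n q_k^m + 2 t_k q_l^n + γ_k g_l^n )`. -/
def CondQ (g : Comp 2) (T : Comp 3) (τ : Comp 2) (dt : Comp 1) (y : Plane) : Prop :=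
  let E := fun k l n : Fin 2 =>
    (∑ r, gInv g y n r * cov g (qten g T τ) y ![k, r, l])
      + (∑ m, Tup g T y m l n * qup g T τ y k m)
      + 2 * dt y ![k] * qup g T τ y l n
      + gam g T τ y ![k] * (if l = n then 1 else 0)
  ∀ k l n, E k l n - E l k n = 0

/-- `0 = Alt_{ij} ( γ_{i,j} + q_i^m τ_{mj} + 2 t_i γ_j )`. -/
def CondGamma (g : Comp 2) (T : Comp 3) (τ : Comp 2) (dt : Comp 1) (y : Plane) : Prop :=
  let E := fun i j : Fin 2 =>
    cov g (gam g T τ) y ![i, j] + (∑ m, qup g T τ y i m * τ y ![m, j])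
      + 2 * dt y ![i] * gam g T τ y ![j]
  ∀ i j, E i j - E j i = 0

end Superint

end

open Superint

/-!
The equivalence is, at each point of a chart, a finite-dimensional algebraic statement. Write
`θ` for the 1-form `t_j = ½ T_{aj}^a` and `S` for what remains of `T` after subtracting
`θ_i g_{jk} + θ_j g_{ik} - g_{ij} θ_k`. In dimension two a tensor that is symmetric and trace-free
in its first two slots has only four parameters, so `S` is automatically totally symmetric and
trace-free (`Spart_symm_trace`), and the pair `(S, θ)` is determined by `T` (`condT_unique`). In a
frame in which the metric is `diag(±1, ±1)`, the tensors `S`, `θ`, `τ` and their covariant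
derivatives are described by a few numbers (`FrameData`), and every condition becomes polynomial in them.

* The Ricci identity for `C` reduces to four scalar equations (`FrameData.ricciC_iff`): `θ` is
  closed, `div θ = ⅓ |S|² + (3/2) R`, and the two components of the equation for the trace-free
  part of `∇S`.
* The first Ricci identity for `V` holds identically: the second equation of the system is its
  trace, and in dimension two it has no further components (`FrameData.thirdV_symm`). In the
  second one, the coefficients of `V_{,m}` and `V` are the last two structural conditions, and the
  coefficient of `ΔV` vanishes exactly when `θ` is closed (`FrameData.ricciV_iff`).
* The prescribed value of `τ` agrees with the stated formula once `θ` is closed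
  (`FrameData.condTau_iff`).

Hence the integrability conditions say that `θ` is closed and that the structural conditions hold
with `dt = θ` (`TensorsAt.integrability_iff`). The passage to these parameters uses that the
covariant derivative preserves symmetries and traces and that the curvature of a surface is
determined by its scalar curvature (`riem_eq_scal`).

Globally, `θ` and `S` are tensor fields (`traceForm`, `symField`), and the Poincaré lemma provides
local potentials of the closed form `θ`, whose differential is `θ` in all charts
(`exists_potential`). Conversely, a decomposition of `T` with `dt` in place of `θ` forces
`dt = θ`, and `dt` is closed.
-/

noncomputable section

namespace Superint

/-! ### Contractions in an orthonormal frame -/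

/-- A vector or covector of the plane, given by its two components in an orthonormal frame. -/
abbrev Pair : Type := ℝ × ℝ

/-- `g = p e¹ ⊗ e¹ + q e² ⊗ e²` at `y` with signs `p, q = ±1`; here `E i` are the components
of the `i`-th coordinate vector in the orthonormal frame. -/
structure IsFrame (g : Comp 2) (y : Plane) (p q : ℝ) (E : Fin 2 → Pair) : Prop where
  hp : p = 1 ∨ p = -1
  hq : q = 1 ∨ q = -1
  met : ∀ i j, g y ![i, j] = p * (E i).1 * (E j).1 + q * (E i).2 * (E j).2
  indep : (E 0).1 * (E 1).2 - (E 0).2 * (E 1).1 ≠ 0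

/-- Bilinearity of a function of two vectors, written out in components. -/
def Bil (Φ : Pair → Pair → ℝ) : Prop := ∀ x y, Φ x y =
  x.1 * y.1 * Φ (1, 0) (1, 0) + x.1 * y.2 * Φ (1, 0) (0, 1)
    + x.2 * y.1 * Φ (0, 1) (1, 0) + x.2 * y.2 * Φ (0, 1) (0, 1)

/-- Linearity of a function of a vector, written out in components. -/
def Lin (Φ : Pair → ℝ) : Prop := ∀ x, Φ x = x.1 * Φ (1, 0) + x.2 * Φ (0, 1)

/-- The entries of the inverse of a `2 × 2` matrix. -/
theorem gInv_eq (g : Comp 2) (y : Plane) (a b : Fin 2) :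
    gInv g y a b = (g y ![0, 0] * g y ![1, 1] - g y ![0, 1] * g y ![1, 0])⁻¹ *
      (!![g y ![1, 1], -g y ![0, 1]; -g y ![1, 0], g y ![0, 0]] a b) := by
  unfold gInv
  rw [Matrix.inv_def, Matrix.adjugate_fin_two, Matrix.det_fin_two]
  simp [Ring.inverse_eq_inv']

namespace IsFrame

variable {g : Comp 2} {y : Plane} {p q : ℝ} {E : Fin 2 → Pair}

theorem det_eq (h : IsFrame g y p q E) :
    g y ![0, 0] * g y ![1, 1] - g y ![0, 1] * g y ![1, 0]
      = p * q * ((E 0).1 * (E 1).2 - (E 0).2 * (E 1).1) ^ 2 := by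
  simp only [h.met]; ring

/-- Contraction with the inverse metric, computed in the frame. -/
theorem contract (h : IsFrame g y p q E) {Φ : Pair → Pair → ℝ} (hΦ : Bil Φ) :
    ∑ a, ∑ b, gInv g y a b * Φ (E a) (E b)
      = p * Φ (1, 0) (1, 0) + q * Φ (0, 1) (0, 1) := by
  have hd := h.indep
  have key : ∀ A B C D : ℝ,
      ∑ a, ∑ b, gInv g y a b * ((E a).1 * (E b).1 * A + (E a).1 * (E b).2 * B
        + (E a).2 * (E b).1 * C + (E a).2 * (E b).2 * D) = p * A + q * D := by
    intro A B C D
    obtain ⟨w, hw⟩ : ∃ w, w * ((E 0).1 * (E 1).2 - (E 0).2 * (E 1).1) = 1 :=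
      ⟨_, inv_mul_cancel₀ hd⟩
    have hinv : (g y ![0, 0] * g y ![1, 1] - g y ![0, 1] * g y ![1, 0])⁻¹ = p * q * w ^ 2 := by
      rw [h.det_eq]
      apply inv_eq_of_mul_eq_one_left
      have hw2 : (w * ((E 0).1 * (E 1).2 - (E 0).2 * (E 1).1)) ^ 2 = 1 := by rw [hw]; norm_num
      rcases h.hp with rfl | rfl <;> rcases h.hq with rfl | rfl <;> linear_combination hw2
    simp only [gInv_eq, hinv]
    simp only [Fin.sum_univ_two, Matrix.of_apply, Matrix.cons_val', Matrix.cons_val_zero,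
      Matrix.cons_val_one, Matrix.cons_val_fin_one, h.met]
    rcases h.hp with rfl | rfl <;> rcases h.hq with rfl | rfl
    · linear_combination (A + D) * (w * ((E 0).1 * (E 1).2 - (E 0).2 * (E 1).1) + 1) * hw
    · linear_combination (A - D) * (w * ((E 0).1 * (E 1).2 - (E 0).2 * (E 1).1) + 1) * hw
    · linear_combination (-A + D) * (w * ((E 0).1 * (E 1).2 - (E 0).2 * (E 1).1) + 1) * hw
    · linear_combination (-A - D) * (w * ((E 0).1 * (E 1).2 - (E 0).2 * (E 1).1) + 1) * hw
  rw [← key (Φ (1, 0) (1, 0)) (Φ (1, 0) (0, 1)) (Φ (0, 1) (1, 0)) (Φ (0, 1) (0, 1))]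
  refine Finset.sum_congr rfl fun a _ => Finset.sum_congr rfl fun b _ => ?_
  rw [hΦ (E a) (E b)]

/-- Raising an index and contracting. -/
theorem contract_up (h : IsFrame g y p q E) {Φ Ψ : Pair → ℝ} (hΦ : Lin Φ) (hΨ : Lin Ψ) :
    ∑ m, (∑ n, gInv g y m n * Φ (E n)) * Ψ (E m)
      = p * (Φ (1, 0) * Ψ (1, 0)) + q * (Φ (0, 1) * Ψ (0, 1)) := by
  have := h.contract (Φ := fun x z => Φ z * Ψ x) (by
    intro x z; simp only [hΦ z, hΨ x]; ring)
  rw [← this]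
  simp only [Finset.sum_mul, mul_assoc]

/-- Raising two indices and contracting. -/
theorem contract_up_two (h : IsFrame g y p q E) {Φ Ψ : Pair → Pair → ℝ} (hΦ : Bil Φ) (hΨ : Bil Ψ) :
    ∑ m, ∑ n, (∑ r, ∑ s, gInv g y m r * gInv g y n s * Φ (E r) (E s)) * Ψ (E m) (E n)
      = Φ (1, 0) (1, 0) * Ψ (1, 0) (1, 0) + p * q * (Φ (1, 0) (0, 1) * Ψ (1, 0) (0, 1))
        + p * q * (Φ (0, 1) (1, 0) * Ψ (0, 1) (1, 0)) + Φ (0, 1) (0, 1) * Ψ (0, 1) (0, 1) := by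
  have h1 : ∀ m r, ∑ n, ∑ s, gInv g y n s * (Φ (E r) (E s) * Ψ (E m) (E n))
      = p * (Φ (E r) (1, 0) * Ψ (E m) (1, 0)) + q * (Φ (E r) (0, 1) * Ψ (E m) (0, 1)) := by
    intro m r
    exact h.contract (Φ := fun x z => Φ (E r) z * Ψ (E m) x) (by
      intro x z
      simp only [hΦ (E r) _, hΨ (E m) _]
      ring)
  have h2 := h.contract
    (Φ := fun x z => p * (Φ z (1, 0) * Ψ x (1, 0)) + q * (Φ z (0, 1) * Ψ x (0, 1)))
    (by
      intro x z
      simp only [hΦ z _, hΨ x _]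
      ring)
  calc _ = ∑ m, ∑ r, gInv g y m r * (∑ n, ∑ s, gInv g y n s * (Φ (E r) (E s) * Ψ (E m) (E n))) := by
        simp only [Fin.sum_univ_two]; ring
    _ = _ := by
        simp only [h1, h2]
        rcases h.hp with rfl | rfl <;> rcases h.hq with rfl | rfl <;> ring

/-- Contracting three pairs of indices. -/
theorem contract_three (h : IsFrame g y p q E) {Φ : Pair → Pair → Pair → Pair → Pair → Pair → ℝ}
    (h1 : ∀ b c b' c', Bil fun a a' => Φ a b c a' b' c')
    (h2 : ∀ a c a' c', Bil fun b b' => Φ a b c a' b' c')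
    (h3 : ∀ a b a' b', Bil fun c c' => Φ a b c a' b' c') :
    ∑ a, ∑ b, ∑ c, ∑ a', ∑ b', ∑ c', gInv g y a a' * gInv g y b b' * gInv g y c c' *
        Φ (E a) (E b) (E c) (E a') (E b') (E c')
      = p * (p * (p * Φ (1, 0) (1, 0) (1, 0) (1, 0) (1, 0) (1, 0)
                + q * Φ (1, 0) (1, 0) (0, 1) (1, 0) (1, 0) (0, 1))
            + q * (p * Φ (1, 0) (0, 1) (1, 0) (1, 0) (0, 1) (1, 0)
                + q * Φ (1, 0) (0, 1) (0, 1) (1, 0) (0, 1) (0, 1)))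
        + q * (p * (p * Φ (0, 1) (1, 0) (1, 0) (0, 1) (1, 0) (1, 0)
                + q * Φ (0, 1) (1, 0) (0, 1) (0, 1) (1, 0) (0, 1))
            + q * (p * Φ (0, 1) (0, 1) (1, 0) (0, 1) (0, 1) (1, 0)
                + q * Φ (0, 1) (0, 1) (0, 1) (0, 1) (0, 1) (0, 1))) := by
  have reorder : ∀ F : Fin 2 → Fin 2 → Fin 2 → Fin 2 → Fin 2 → Fin 2 → ℝ,
      ∑ a, ∑ b, ∑ c, ∑ a', ∑ b', ∑ c', gInv g y a a' * gInv g y b b' * gInv g y c c' *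
        F a b c a' b' c'
      = ∑ a, ∑ a', gInv g y a a' * (∑ b, ∑ b', gInv g y b b' *
          (∑ c, ∑ c', gInv g y c c' * F a b c a' b' c')) := by
    intro F
    simp only [Fin.sum_univ_two]; ring
  rw [reorder]
  have s3 := fun a b a' b' => h.contract (h3 a b a' b')
  have s2 := fun a c a' c' => h.contract (h2 a c a' c')
  have s1 := fun b c b' c' => h.contract (h1 b c b' c')
  beta_reduce at s1 s2 s3
  have dist : ∀ (F G : Fin 2 → Fin 2 → ℝ), ∑ a, ∑ b, gInv g y a b * (p * F a b + q * G a b)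
      = p * (∑ a, ∑ b, gInv g y a b * F a b) + q * (∑ a, ∑ b, gInv g y a b * G a b) := by
    intro F G
    simp only [Fin.sum_univ_two]; ring
  simp only [s3, s2, s1, dist]
  ring

/-- A linear form vanishing on both coordinate vectors is zero. -/
theorem ext (h : IsFrame g y p q E) {A B : ℝ} (h0 : ∀ i, (E i).1 * A + (E i).2 * B = 0) :
    A = 0 ∧ B = 0 := by
  have hd := h.indep
  have e0 := h0 0
  have e1 := h0 1
  constructor
  · apply (mul_eq_zero.1 (?_ : ((E 0).1 * (E 1).2 - (E 0).2 * (E 1).1) * A = 0)).resolve_left hd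
    linear_combination (E 1).2 * e0 - (E 0).2 * e1
  · apply (mul_eq_zero.1 (?_ : ((E 0).1 * (E 1).2 - (E 0).2 * (E 1).1) * B = 0)).resolve_left hd
    linear_combination (E 0).1 * e1 - (E 1).1 * e0

/-- Components of a covector in the frame. -/
theorem exists_comp (h : IsFrame g y p q E) (F : Fin 2 → ℝ) :
    ∃ A B : ℝ, ∀ i, F i = (E i).1 * A + (E i).2 * B := by
  have hd := h.indep
  obtain ⟨w, hw⟩ : ∃ w, w * ((E 0).1 * (E 1).2 - (E 0).2 * (E 1).1) = 1 :=
    ⟨_, inv_mul_cancel₀ hd⟩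
  refine ⟨(F 0 * (E 1).2 - F 1 * (E 0).2) * w, (F 1 * (E 0).1 - F 0 * (E 1).1) * w,
    Fin.forall_fin_two.2 ⟨?_, ?_⟩⟩
  · linear_combination (-F 0) * hw
  · linear_combination (-F 1) * hw

end IsFrame

/-- A non-degenerate symmetric form on the plane can be diagonalised with entries `±1`. -/
theorem exists_isFrame (g : Comp 2) (y : Plane) (hs : g y ![0, 1] = g y ![1, 0])
    (hd : g y ![0, 0] * g y ![1, 1] - g y ![0, 1] * g y ![1, 0] ≠ 0) :
    ∃ p q E, IsFrame g y p q E := by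
  -- every nonzero real is a sign times a square
  have sq : ∀ x : ℝ, x ≠ 0 → ∃ s r : ℝ, (s = 1 ∨ s = -1) ∧ r ≠ 0 ∧ x = s * r ^ 2 := by
    intro x hx
    rcases lt_or_gt_of_ne hx with h | h
    · refine ⟨-1, √(-x), Or.inr rfl, (Real.sqrt_pos.2 (by linarith)).ne', ?_⟩
      rw [Real.sq_sqrt (by linarith)]; ring
    · refine ⟨1, √x, Or.inl rfl, (Real.sqrt_pos.2 h).ne', ?_⟩
      rw [Real.sq_sqrt h.le]; ring
  -- completing the square
  have diag : ∀ a b d : ℝ, a ≠ 0 → a * d - b * b ≠ 0 → ∃ p q x z w : ℝ, (p = 1 ∨ p = -1) ∧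
      (q = 1 ∨ q = -1) ∧ a = p * x * x ∧ b = p * x * z ∧ d = p * z * z + q * w * w ∧ x * w ≠ 0 := by
    intro a b d ha hdet
    obtain ⟨p, x, hp, hx, hax⟩ := sq a ha
    have h2 : d - b ^ 2 / a ≠ 0 := by
      intro h
      apply hdet
      field_simp at h
      linarith
    obtain ⟨q, w, hq, hw, hqw⟩ := sq _ h2
    have hp2 : p * p = 1 := by rcases hp with rfl | rfl <;> norm_num
    have hp0 : p ≠ 0 := by rcases hp with rfl | rfl <;> norm_num
    refine ⟨p, q, x, p * b / x, w, hp, hq, by rw [hax]; ring, ?_, ?_, mul_ne_zero hx hw⟩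
    · field_simp; linear_combination (-b) * hp2
    · have : d = b ^ 2 / a + q * w ^ 2 := by linarith
      rw [this, hax]
      field_simp
      linear_combination (-b^2 * (1 + p ^ 2)) * hp2
  generalize h00 : g y ![0, 0] = a at *
  generalize h11 : g y ![1, 1] = d at *
  generalize h10 : g y ![1, 0] = b at *
  rw [hs] at hd
  by_cases ha : a = 0
  · by_cases hd0 : d = 0
    · -- the hyperbolic plane: `2 b x y = ½ b ((x + y)² - (x - y)²)`
      have hb : b ≠ 0 := by rintro rfl; simp [ha] at hd
      refine ⟨1, -1, ![(1, 1), (b / 2, -b / 2)], Or.inl rfl, Or.inr rfl, ?_, ?_⟩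
      · intro i j
        fin_cases i <;> fin_cases j <;> simp [h00, h11, h10, hs, ha, hd0] <;> ring
      · simp only [Matrix.cons_val_zero, Matrix.cons_val_one, Matrix.cons_val_fin_one]
        intro h; apply hb; linarith
    · obtain ⟨p, q, x, z, w, hp, hq, e1, e2, e3, e4⟩ := diag d b a hd0 (by rwa [mul_comm d a])
      refine ⟨p, q, ![(z, w), (x, 0)], hp, hq, ?_, ?_⟩
      · intro i j
        fin_cases i <;> fin_cases j <;> simp [h00, h11, h10, hs] <;> linarith
      · simp only [Matrix.cons_val_zero, Matrix.cons_val_one, Matrix.cons_val_fin_one]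
        intro h; apply e4; linarith
  · obtain ⟨p, q, x, z, w, hp, hq, e1, e2, e3, e4⟩ := diag a b d ha hd
    refine ⟨p, q, ![(x, 0), (z, w)], hp, hq, ?_, ?_⟩
    · intro i j
      fin_cases i <;> fin_cases j <;> simp [h00, h11, h10, hs] <;> linarith
    · simp only [Matrix.cons_val_zero, Matrix.cons_val_one, Matrix.cons_val_fin_one]
      intro h; apply e4; linarith

/-! ### The structure tensors in an orthonormal frame -/

/-- The algebraic expression defining `Pten`, for an arbitrary set of index values. -/
def Palg {ι : Type*} (G : ι → ι → ℝ) (T : ι → ι → ι → ℝ) (t : ι → ℝ) (i j k m n : ι) : ℝ :=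
  let A := fun m n : ι =>
    (T m j i * G k n - T m k i * G j n) + (T m i j * G k n - T m k j * G i n)
      + G i j * (T m k n - 2 * t m * G k n)
  (1 / 6) * (A m n + A n m)

/-- The algebraic expression defining `Lam`, for an arbitrary set of index values. -/
def Lalg {ι : Type*} (G : ι → ι → ℝ) (T : ι → ι → ι → ℝ) (t : ι → ℝ) (k a b : ι) : ℝ :=
  (1 / 6) * ((T k a b - 2 * t a * G b k) + (T k b a - 2 * t b * G a k))

/-- `t_i g_{jk} + t_j g_{ik} - g_{ij} t_k`. -/
def tracePart {ι : Type*} (G : ι → ι → ℝ) (t : ι → ℝ) (i j k : ι) : ℝ :=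
  t i * G j k + t j * G i k - G i j * t k

/-- The metric in an orthonormal frame. -/
def Gf (p q : ℝ) (x y : Pair) : ℝ := p * x.1 * y.1 + q * x.2 * y.2

/-- The covector with components `t.1, t.2`. -/
def tf (t : Pair) (x : Pair) : ℝ := t.1 * x.1 + t.2 * x.2

/-- The totally symmetric trace-free tensor of rank three with `S₁₁₁ = s.1` and `S₁₁₂ = s.2`. -/
def Sf (p q : ℝ) (s : Pair) (x y z : Pair) : ℝ :=
  s.1 * (x.1 * y.1 * z.1 - p * q * (x.1 * y.2 * z.2 + x.2 * y.1 * z.2 + x.2 * y.2 * z.1))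
    + s.2 * (x.1 * y.1 * z.2 + x.1 * y.2 * z.1 + x.2 * y.1 * z.1 - p * q * (x.2 * y.2 * z.2))

/-- The general tensor of rank three that is symmetric and trace-free in its first two slots. -/
def Tf (p q : ℝ) (s t : Pair) (x y z : Pair) : ℝ :=
  Sf p q s x y z + tracePart (Gf p q) (tf t) x y z

/-- The symmetric trace-free tensor of rank two with `C₁₁ = p c.1` and `C₁₂ = c.2`. -/
def Cf (p q : ℝ) (c : Pair) (x y : Pair) : ℝ :=
  c.1 * (p * x.1 * y.1 - q * x.2 * y.2) + c.2 * (x.1 * y.2 + x.2 * y.1)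

/-- `P_{ijkmn}` in an orthonormal frame. -/
def Pf (p q : ℝ) (s t : Pair) : Pair → Pair → Pair → Pair → Pair → ℝ :=
  Palg (Gf p q) (Tf p q s t) (tf t)

/-- `Λ_{kab}` in an orthonormal frame. -/
def Lf (p q : ℝ) (s t : Pair) : Pair → Pair → Pair → ℝ :=
  Lalg (Gf p q) (Tf p q s t) (tf t)

/-- The parameters of `P_{ijk}^{mn} C_{mn}`, as a symmetric trace-free tensor in `(i, j)`. -/
def dCpar (p q : ℝ) (s t c k : Pair) : Pair :=
  (2 / 3 * (s.1 * (p * c.1 * k.1 + c.2 * k.2) + s.2 * (-p * c.1 * k.2 + p * q * c.2 * k.1)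
      + t.1 * (-c.1 * k.1 + p * c.2 * k.2) + t.2 * (-c.1 * k.2 - q * c.2 * k.1)),
   2 / 3 * (s.1 * (p * q * c.1 * k.2 - p * c.2 * k.1) + s.2 * (c.1 * k.1 + p * c.2 * k.2)
      + t.1 * (-q * c.1 * k.2 - c.2 * k.1) + t.2 * (p * c.1 * k.1 - c.2 * k.2)))

/-- The pair of linear functions of `x` with coefficients `a.1`, `a.2`. -/
def lin2 (a : Pair × Pair) (x : Pair) : Pair := (tf a.1 x, tf a.2 x)

theorem bil_Cf (p q : ℝ) (c : Pair) : Bil (Cf p q c) := by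
  intro x y; simp only [Cf]; ring

theorem lin_tf (t : Pair) : Lin (tf t) := by
  intro x; simp only [tf]; ring

theorem bil_Pf (p q : ℝ) (s t i j k : Pair) : Bil (fun m n => Pf p q s t i j k m n) := by
  intro x y; simp only [Pf, Palg, Tf, Sf, Gf, tf, tracePart]; ring

/-- The contraction `P_{ijk}^{mn} C_{mn}` is symmetric and trace-free in `(i, j)`, with parameters
`dCpar`. -/
theorem Pf_contract {p q : ℝ} (hp : p = 1 ∨ p = -1) (hq : q = 1 ∨ q = -1) (s t c i j k : Pair) :
    Pf p q s t i j k (1, 0) (1, 0) * Cf p q c (1, 0) (1, 0)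
      + p * q * (Pf p q s t i j k (1, 0) (0, 1) * Cf p q c (1, 0) (0, 1))
      + p * q * (Pf p q s t i j k (0, 1) (1, 0) * Cf p q c (0, 1) (1, 0))
      + Pf p q s t i j k (0, 1) (0, 1) * Cf p q c (0, 1) (0, 1)
      = Cf p q (dCpar p q s t c k) i j := by
  simp only [Pf, Palg, Tf, Sf, Gf, tf, Cf, dCpar, tracePart]
  rcases hp with rfl | rfl <;> rcases hq with rfl | rfl <;> ring

theorem Pten_eq (g : Comp 2) (T : Comp 3) (y : Plane) (i j k m n : Fin 2) :
    Pten g T y ![i, j, k, m, n] = Palg (fun i j => g y ![i, j]) (fun i j k => T y ![i, j, k])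
      (fun i => tForm g T y ![i]) i j k m n := rfl

theorem Lam_eq (g : Comp 2) (T : Comp 3) (y : Plane) (i j k : Fin 2) :
    Lam g T y ![i, j, k] = Lalg (fun i j => g y ![i, j]) (fun i j k => T y ![i, j, k])
      (fun i => tForm g T y ![i]) i j k := rfl

/-- The values at `y` of the tensor fields entering the integrability conditions, in an orthonormal
frame: `s` and `t` are the parameters of the trace-free part and of the trace of `T`, while `ds`
and `dt` are those of their covariant derivatives, `u` and `du` are the parameters of `τ` and of its
covariant derivative, and `κ` is half the scalar curvature. -/
structure FrameData (g : Comp 2) (T S : Comp 3) (τ : Comp 2) (y : Plane) (p q : ℝ)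
    (E : Fin 2 → Pair) (s t u : Pair) (ds dt du : Pair × Pair) (κ : ℝ) : Prop
    extends IsFrame g y p q E where
  T_eq : ∀ i j k, T y ![i, j, k] = Tf p q s t (E i) (E j) (E k)
  S_eq : ∀ i j k, S y ![i, j, k] = Sf p q s (E i) (E j) (E k)
  t_eq : ∀ i, tForm g T y ![i] = tf t (E i)
  τ_eq : ∀ i j, τ y ![i, j] = Cf p q u (E i) (E j)
  dS_eq : ∀ i j k l, cov g S y ![i, j, k, l] = Sf p q (lin2 ds (E l)) (E i) (E j) (E k)
  dT_eq : ∀ i j k l, cov g T y ![i, j, k, l]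
    = Tf p q (lin2 ds (E l)) (lin2 dt (E l)) (E i) (E j) (E k)
  dt_eq : ∀ i l, cov g (tForm g T) y ![i, l] = tf (lin2 dt (E l)) (E i)
  dτ_eq : ∀ i j l, cov g τ y ![i, j, l] = Cf p q (lin2 du (E l)) (E i) (E j)
  dP_eq : ∀ i j k m n l, cov g (Pten g T) y ![i, j, k, m, n, l]
    = Pf p q (lin2 ds (E l)) (lin2 dt (E l)) (E i) (E j) (E k) (E m) (E n)
  dL_eq : ∀ i j k l, cov g (Lam g T) y ![i, j, k, l]
    = Lf p q (lin2 ds (E l)) (lin2 dt (E l)) (E i) (E j) (E k)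
  riem_eq : ∀ (i j k : Fin 2) (w : Fin 2 → ℝ), ∑ m, riem g y m i j k * w m
    = κ * (g y ![i, k] * w j - g y ![i, j] * w k)
  scal_eq : scal g y = 2 * κ

/-- A linear function vanishing on the coordinate vectors vanishes. -/
theorem zero_of_lin {g : Comp 2} {y : Plane} {p q : ℝ} {E : Fin 2 → Pair} (h : IsFrame g y p q E)
    {Φ : Pair → ℝ} (hΦ : Lin Φ) (h0 : ∀ i, Φ (E i) = 0) (x : Pair) : Φ x = 0 := by
  have := h.ext (A := Φ (1, 0)) (B := Φ (0, 1)) fun i => by rw [← hΦ]; exact h0 i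
  rw [hΦ x, this.1, this.2]; ring

namespace FrameData

variable {g : Comp 2} {T S : Comp 3} {τ : Comp 2} {y : Plane} {p q : ℝ} {E : Fin 2 → Pair}
  {s t u : Pair} {ds dt du : Pair × Pair} {κ : ℝ}

theorem P_eq (h : FrameData g T S τ y p q E s t u ds dt du κ) (i j k m n : Fin 2) :
    Pten g T y ![i, j, k, m, n] = Pf p q s t (E i) (E j) (E k) (E m) (E n) := by
  rw [Pten_eq]
  simp only [h.met, h.T_eq, h.t_eq]
  rfl

theorem L_eq (h : FrameData g T S τ y p q E s t u ds dt du κ) (i j k : Fin 2) :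
    Lam g T y ![i, j, k] = Lf p q s t (E i) (E j) (E k) := by
  rw [Lam_eq]
  simp only [h.met, h.T_eq, h.t_eq]
  rfl

theorem dC_eq (h : FrameData g T S τ y p q E s t u ds dt du κ) {c : Fin 2 → Fin 2 → ℝ} {c' : Pair}
    (hc : ∀ i j, c i j = Cf p q c' (E i) (E j)) (i j k : Fin 2) :
    dC g T y c i j k = Cf p q (dCpar p q s t c' (E k)) (E i) (E j) := by
  simp only [dC, hc, h.P_eq]
  rw [h.contract_up_two (bil_Pf p q s t (E i) (E j) (E k)) (bil_Cf p q c')]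
  exact Pf_contract h.hp h.hq s t c' (E i) (E j) (E k)

/-- Parameters of `C_{ij,kl}`. -/
theorem ddC_eq (h : FrameData g T S τ y p q E s t u ds dt du κ) {c : Fin 2 → Fin 2 → ℝ} {c' : Pair}
    (hc : ∀ i j, c i j = Cf p q c' (E i) (E j)) (i j k l : Fin 2) :
    ddC g T y c i j k l
      = Cf p q (dCpar p q (lin2 ds (E l)) (lin2 dt (E l)) c' (E k)) (E i) (E j)
        + Cf p q (dCpar p q s t (dCpar p q s t c' (E l)) (E k)) (E i) (E j) := by
  simp only [ddC, h.dC_eq hc, hc, h.P_eq, h.dP_eq, Finset.sum_add_distrib]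
  rw [h.contract_up_two (bil_Pf p q _ _ (E i) (E j) (E k)) (bil_Cf p q c'),
    h.contract_up_two (bil_Pf p q s t (E i) (E j) (E k)) (bil_Cf p q _),
    Pf_contract h.hp h.hq, Pf_contract h.hp h.hq]

end FrameData

/-! ### The integrability conditions of the system for `C` -/

theorem sym4_eq (X : (Fin 4 → Fin 2) → ℝ) (i j k l : Fin 2) : sym4 X ![i, j, k, l] =
    X ![i, j, k, l] + X ![i, j, l, k] + X ![i, k, j, l] + X ![i, k, l, j] + X ![i, l, j, k]
    + X ![i, l, k, j] + X ![j, i, k, l] + X ![j, i, l, k] + X ![j, k, i, l] + X ![j, k, l, i]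
    + X ![j, l, i, k] + X ![j, l, k, i] + X ![k, i, j, l] + X ![k, i, l, j] + X ![k, j, i, l]
    + X ![k, j, l, i] + X ![k, l, i, j] + X ![k, l, j, i] + X ![l, i, j, k] + X ![l, i, k, j]
    + X ![l, j, i, k] + X ![l, j, k, i] + X ![l, k, i, j] + X ![l, k, j, i] := by
  have hI : ∀ σ : Equiv.Perm (Fin 4), (fun a => (![i, j, k, l] : Fin 4 → Fin 2) (σ a))
      = (fun v : Fin 4 → Fin 4 => ![(![i, j, k, l] : Fin 4 → Fin 2) (v 0),
        (![i, j, k, l] : Fin 4 → Fin 2) (v 1), (![i, j, k, l] : Fin 4 → Fin 2) (v 2),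
        (![i, j, k, l] : Fin 4 → Fin 2) (v 3)]) ![σ 0, σ 1, σ 2, σ 3] := by
    intro σ; ext a; fin_cases a <;> rfl
  have him : (Finset.univ : Finset (Equiv.Perm (Fin 4))).image
      (fun σ => (![σ 0, σ 1, σ 2, σ 3] : Fin 4 → Fin 4)) =
      {![0, 1, 2, 3], ![0, 1, 3, 2], ![0, 2, 1, 3], ![0, 2, 3, 1], ![0, 3, 1, 2], ![0, 3, 2, 1],
       ![1, 0, 2, 3], ![1, 0, 3, 2], ![1, 2, 0, 3], ![1, 2, 3, 0], ![1, 3, 0, 2], ![1, 3, 2, 0],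
       ![2, 0, 1, 3], ![2, 0, 3, 1], ![2, 1, 0, 3], ![2, 1, 3, 0], ![2, 3, 0, 1], ![2, 3, 1, 0],
       ![3, 0, 1, 2], ![3, 0, 2, 1], ![3, 1, 0, 2], ![3, 1, 2, 0], ![3, 2, 0, 1],
       ![3, 2, 1, 0]} := by
    decide +kernel
  have hinj : Function.Injective
      (fun σ : Equiv.Perm (Fin 4) => (![σ 0, σ 1, σ 2, σ 3] : Fin 4 → Fin 4)) := by
    intro σ ρ hσ
    ext a
    have := congrFun hσ a
    fin_cases a <;> simpa using congrArg Fin.val this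
  -- the sum over permutations becomes a sum over the list of their values
  simp only [sym4, hI]
  rw [← Finset.sum_image (f := fun v : Fin 4 → Fin 4 => X ((fun v : Fin 4 → Fin 4 =>
    ![(![i, j, k, l] : Fin 4 → Fin 2) (v 0),
        (![i, j, k, l] : Fin 4 → Fin 2) (v 1), (![i, j, k, l] : Fin 4 → Fin 2) (v 2),
        (![i, j, k, l] : Fin 4 → Fin 2) (v 3)]) v)) (fun a _ b _ hab => hinj hab), him]
  repeat rw [Finset.sum_insert (by decide)]
  rw [Finset.sum_singleton]
  simp only [Matrix.cons_val]
  ring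

/-- Parameters of the defect in the Ricci identity of a symmetric trace-free tensor with
parameters `c`: `m₁` is the failure of `t` to be closed, `m₂` that of the Laplace equation, and
`m₃`, `m₄` those of the equation for the trace-free part of `∇S`. -/
def defect (p q m₁ m₂ m₃ m₄ : ℝ) (c : Pair) : Pair :=
  (2 / 3 * (-m₁ * c.1 + p * m₄ * c.1 - m₂ * c.2 - m₃ * c.2),
   2 / 3 * (p * q * (m₂ * c.1 - m₃ * c.1) - m₁ * c.2 - p * m₄ * c.2))

/-- The difference of the two sides of the Ricci identity for `C`, antisymmetric in the indices of
differentiation, is a multiple of a single symmetric trace-free tensor. -/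
theorem ricci_defect {p q : ℝ} (hp : p = 1 ∨ p = -1) (hq : q = 1 ∨ q = -1) (s t c : Pair)
    (ds dt : Pair × Pair) (κ : ℝ) (i j k l : Pair) :
    Cf p q (dCpar p q (lin2 ds l) (lin2 dt l) c k) i j
      + Cf p q (dCpar p q s t (dCpar p q s t c l) k) i j
      - (Cf p q (dCpar p q (lin2 ds k) (lin2 dt k) c l) i j
        + Cf p q (dCpar p q s t (dCpar p q s t c k) l) i j)
      - (κ * (Gf p q i l * Cf p q c k j - Gf p q i k * Cf p q c l j)
        + κ * (Gf p q j l * Cf p q c i k - Gf p q j k * Cf p q c i l))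
    = (k.1 * l.2 - k.2 * l.1) * Cf p q (defect p q (dt.1.2 - dt.2.1)
        (p * dt.1.1 + q * dt.2.2 - 4 / 3 * (p * s.1 ^ 2 + q * s.2 ^ 2) - 3 * κ)
        (ds.1.1 - p * q * ds.2.2 - 4 / 3 * (s.1 * t.1 - p * q * s.2 * t.2))
        (ds.1.2 + ds.2.1 - 4 / 3 * (s.1 * t.2 + s.2 * t.1)) c) i j := by
  simp only [Cf, dCpar, lin2, tf, Gf, defect]
  rcases hp with rfl | rfl <;> rcases hq with rfl | rfl <;> ring

/-- The components of a symmetric trace-free tensor of rank two in an orthonormal frame. -/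
theorem IsFrame.exists_eq_Cf {g : Comp 2} {y : Plane} {p q : ℝ} {E : Fin 2 → Pair}
    (h : IsFrame g y p q E) {c : Fin 2 → Fin 2 → ℝ} (hcs : ∀ i j, c i j = c j i)
    (hct : ∑ a, ∑ b, gInv g y a b * c a b = 0) :
    ∃ c' : Pair, ∀ i j, c i j = Cf p q c' (E i) (E j) := by
  obtain ⟨A0, B0, h0⟩ := h.exists_comp (c 0)
  obtain ⟨A1, B1, h1⟩ := h.exists_comp (c 1)
  obtain ⟨x, z, hx⟩ := h.exists_comp ![A0, A1]
  obtain ⟨x', w, hw⟩ := h.exists_comp ![B0, B1]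
  have hc : ∀ i j, c i j = (E j).1 * ((E i).1 * x + (E i).2 * z)
      + (E j).2 * ((E i).1 * x' + (E i).2 * w) := by
    intro i j
    rw [← hx, ← hw]
    fin_cases i
    · exact h0 j
    · exact h1 j
  have hz : z = x' := by
    have := hcs 0 1
    rw [hc, hc] at this
    have h2 : ((E 0).1 * (E 1).2 - (E 0).2 * (E 1).1) * (z - x') = 0 := by
      linear_combination -this
    rcases mul_eq_zero.1 h2 with h3 | h3
    · exact absurd h3 h.indep
    · linarith
  have htr : p * x + q * w = 0 := by
    have := h.contract (Φ := fun a b => b.1 * (a.1 * x + a.2 * z) + b.2 * (a.1 * x' + a.2 * w))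
      (by intro a b; ring)
    simp only [← hc, hct] at this
    linear_combination -this
  refine ⟨(p * x, z), fun i j => ?_⟩
  rw [hc, ← hz]
  simp only [Cf]
  rcases h.hp with rfl | rfl <;> rcases h.hq with rfl | rfl
  · linear_combination (E i).2 * (E j).2 * htr
  · linear_combination -(E i).2 * (E j).2 * htr
  · linear_combination (E i).2 * (E j).2 * htr
  · linear_combination -(E i).2 * (E j).2 * htr

theorem IsFrame.Cf_symm_trace {g : Comp 2} {y : Plane} {p q : ℝ} {E : Fin 2 → Pair}
    (h : IsFrame g y p q E) (c : Pair) :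
    (∀ i j, Cf p q c (E i) (E j) = Cf p q c (E j) (E i)) ∧
      ∑ a, ∑ b, gInv g y a b * Cf p q c (E a) (E b) = 0 := by
  constructor
  · intro i j; simp only [Cf]; ring
  · rw [h.contract (bil_Cf p q c)]
    simp only [Cf]
    rcases h.hp with rfl | rfl <;> rcases h.hq with rfl | rfl <;> ring

/-- A symmetric trace-free tensor determines its parameters. -/
theorem IsFrame.Cf_eq_zero {g : Comp 2} {y : Plane} {p q : ℝ} {E : Fin 2 → Pair}
    (h : IsFrame g y p q E) {c : Pair} (hc : ∀ i j, Cf p q c (E i) (E j) = 0) : c = 0 := by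
  have h1 : ∀ x z, Cf p q c x z = 0 := by
    intro x z
    refine zero_of_lin h (Φ := fun x => Cf p q c x z) (by intro x; simp only [Cf]; ring)
      (fun i => ?_) x
    refine zero_of_lin h (Φ := fun z => Cf p q c (E i) z) (by intro x; simp only [Cf]; ring)
      (fun j => ?_) z
    exact hc i j
  have e1 := h1 (1, 0) (1, 0)
  have e2 := h1 (1, 0) (0, 1)
  simp only [Cf] at e1 e2
  ext
  · rcases h.hp with rfl | rfl <;> simp <;> linarith
  · simp; linarith

namespace FrameData

variable {g : Comp 2} {T S : Comp 3} {τ : Comp 2} {y : Plane} {p q : ℝ} {E : Fin 2 → Pair}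
  {s t u : Pair} {ds dt du : Pair × Pair} {κ : ℝ}

/-- The integrability conditions of the system for `C`, in terms of the parameters. -/
theorem ricciC_iff (h : FrameData g T S τ y p q E s t u ds dt du κ) :
    RicciC g T y ↔ dt.1.2 - dt.2.1 = 0 ∧
      p * dt.1.1 + q * dt.2.2 - 4 / 3 * (p * s.1 ^ 2 + q * s.2 ^ 2) - 3 * κ = 0 ∧
      ds.1.1 - p * q * ds.2.2 - 4 / 3 * (s.1 * t.1 - p * q * s.2 * t.2) = 0 ∧
      ds.1.2 + ds.2.1 - 4 / 3 * (s.1 * t.2 + s.2 * t.1) = 0 := by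
  have key : ∀ (c : Fin 2 → Fin 2 → ℝ) (c' : Pair), (∀ i j, c i j = Cf p q c' (E i) (E j)) →
      ∀ i j k l, ddC g T y c i j k l - ddC g T y c i j l k
        - ∑ m, (riem g y m i k l * c m j + riem g y m j k l * c i m)
        = ((E k).1 * (E l).2 - (E k).2 * (E l).1) * Cf p q (defect p q (dt.1.2 - dt.2.1)
        (p * dt.1.1 + q * dt.2.2 - 4 / 3 * (p * s.1 ^ 2 + q * s.2 ^ 2) - 3 * κ)
        (ds.1.1 - p * q * ds.2.2 - 4 / 3 * (s.1 * t.1 - p * q * s.2 * t.2))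
        (ds.1.2 + ds.2.1 - 4 / 3 * (s.1 * t.2 + s.2 * t.1)) c') (E i) (E j) := by
    intro c c' hc i j k l
    rw [h.ddC_eq hc, h.ddC_eq hc, Finset.sum_add_distrib, h.riem_eq i k l (fun m => c m j),
      h.riem_eq j k l (fun m => c i m)]
    simp only [hc, h.met]
    exact ricci_defect h.hp h.hq s t c' ds dt κ (E i) (E j) (E k) (E l)
  generalize dt.1.2 - dt.2.1 = m₁ at *
  generalize p * dt.1.1 + q * dt.2.2 - 4 / 3 * (p * s.1 ^ 2 + q * s.2 ^ 2) - 3 * κ = m₂ at *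
  generalize ds.1.1 - p * q * ds.2.2 - 4 / 3 * (s.1 * t.1 - p * q * s.2 * t.2) = m₃ at *
  generalize ds.1.2 + ds.2.1 - 4 / 3 * (s.1 * t.2 + s.2 * t.1) = m₄ at *
  constructor
  · intro H
    have h0 : ∀ c, defect p q m₁ m₂ m₃ m₄ c = 0 := by
      intro c
      apply h.Cf_eq_zero
      intro i j
      have h1 := key (fun i j => Cf p q c (E i) (E j)) c (fun _ _ => rfl) i j 0 1
      rw [H _ (h.Cf_symm_trace c).1 (h.Cf_symm_trace c).2, sub_self, eq_comm] at h1
      exact (mul_eq_zero.1 h1).resolve_left h.indep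
    have e1 := h0 (1, 0)
    have e2 := h0 (0, 1)
    simp only [defect, Prod.ext_iff, Prod.fst_zero, Prod.snd_zero] at e1 e2
    obtain ⟨e1, e3⟩ := e1
    obtain ⟨e2, e4⟩ := e2
    rcases h.hp with rfl | rfl <;> rcases h.hq with rfl | rfl <;>
      refine ⟨?_, ?_, ?_, ?_⟩ <;> linarith
  · rintro ⟨rfl, rfl, rfl, rfl⟩ c hcs hct i j k l
    obtain ⟨c', hc⟩ := h.exists_eq_Cf hcs hct
    rw [← sub_eq_zero, key c c' hc]
    simp [Cf, defect]

end FrameData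

/-! ### The conditions on `τ`, `Δt` and `∇S` in an orthonormal frame -/

/-- Parameters of the symmetric trace-free part of
`⅔ ∇²t - (4/9) S(·,·,t) - (8/9) t ⊗ t + ⅓ div S`. -/
def tauPar (p q : ℝ) (s t : Pair) (ds dt : Pair × Pair) : Pair :=
  (1 / 2 * (p * (2 / 3 * dt.1.1 - 4 / 9 * (p * s.1 * t.1 + q * s.2 * t.2) - 8 / 9 * t.1 ^ 2
        + 1 / 3 * (p * ds.1.1 + q * ds.2.2))
      - q * (2 / 3 * dt.2.2 + 4 / 9 * (q * s.1 * t.1 + p * s.2 * t.2) - 8 / 9 * t.2 ^ 2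
        - 1 / 3 * (q * ds.1.1 + p * ds.2.2))),
   1 / 3 * (dt.1.2 + dt.2.1) - 4 / 9 * (p * s.2 * t.1 - p * s.1 * t.2) - 8 / 9 * t.1 * t.2
      + 1 / 3 * (p * ds.2.1 - p * ds.1.2))

/-- The part of the prescribed value of `τ` that is linear in the derivatives of `T`. -/
theorem raw_linear {p q : ℝ} (hp : p = 1 ∨ p = -1) (hq : q = 1 ∨ q = -1)
    (ds dt : Pair × Pair) (i j : Pair) :
    p * Lf p q (lin2 ds (1, 0)) (lin2 dt (1, 0)) i j (1, 0)
      + q * Lf p q (lin2 ds (0, 1)) (lin2 dt (0, 1)) i j (0, 1)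
      - (p * Lf p q (lin2 ds i) (lin2 dt i) (1, 0) j (1, 0)
        + q * Lf p q (lin2 ds i) (lin2 dt i) (0, 1) j (0, 1))
      = Cf p q (tauPar p q 0 0 ds dt) i j := by
  simp only [Lf, Lalg, Tf, Sf, Gf, tf, tracePart, lin2, Cf, tauPar, Prod.fst_zero, Prod.snd_zero]
  rcases hp with rfl | rfl <;> rcases hq with rfl | rfl <;> ring

/-- The part of the prescribed value of `τ` that is quadratic in `T`. -/
theorem raw_quadratic {p q : ℝ} (hp : p = 1 ∨ p = -1) (hq : q = 1 ∨ q = -1)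
    (s t : Pair) (i j : Pair) (Φ : Pair → Pair → Pair → ℝ)
    (hΦ : Φ = fun a b c => Lf p q s t i a b * Pf p q s t a b c c j
      - Lf p q s t c a b * Pf p q s t a b i j c) :
    p * (p * (p * Φ (1, 0) (1, 0) (1, 0) + q * Φ (1, 0) (1, 0) (0, 1))
        + q * (p * Φ (1, 0) (0, 1) (1, 0) + q * Φ (1, 0) (0, 1) (0, 1)))
      + q * (p * (p * Φ (0, 1) (1, 0) (1, 0) + q * Φ (0, 1) (1, 0) (0, 1))
        + q * (p * Φ (0, 1) (0, 1) (1, 0) + q * Φ (0, 1) (0, 1) (0, 1)))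
      = Cf p q (tauPar p q s t 0 0) i j := by
  subst hΦ
  simp only [Lf, Lalg, Pf, Palg, Tf, Sf, Gf, tf, tracePart, Cf, tauPar, Prod.fst_zero,
    Prod.snd_zero]
  rcases hp with rfl | rfl <;> rcases hq with rfl | rfl <;> ring

theorem Lin.mul {Φ Ψ : Pair → ℝ} (hΦ : Lin Φ) (hΨ : Lin Ψ) : Bil fun a b => Φ a * Ψ b := by
  intro x y; dsimp only; rw [hΦ x, hΨ y]; ring

theorem Lin.mul' {Φ Ψ : Pair → ℝ} (hΦ : Lin Φ) (hΨ : Lin Ψ) : Bil fun a b => Φ b * Ψ a := by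
  intro x y; dsimp only; rw [hΦ y, hΨ x]; ring

theorem Bil.const_mul {Φ : Pair → Pair → ℝ} (hΦ : Bil Φ) (r : ℝ) : Bil fun a b => r * Φ a b := by
  intro x y; dsimp only; rw [hΦ x y]; ring

theorem lin_Lf_one (p q : ℝ) (s t a b : Pair) : Lin fun x => Lf p q s t x a b := by
  intro x; simp only [Lf, Lalg, Tf, Sf, Gf, tf, tracePart]; ring

theorem lin_Lf_two (p q : ℝ) (s t a b : Pair) : Lin fun x => Lf p q s t a x b := by
  intro x; simp only [Lf, Lalg, Tf, Sf, Gf, tf, tracePart]; ring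

theorem lin_Lf_three (p q : ℝ) (s t a b : Pair) : Lin fun x => Lf p q s t a b x := by
  intro x; simp only [Lf, Lalg, Tf, Sf, Gf, tf, tracePart]; ring

theorem lin_Pf_one (p q : ℝ) (s t a b c d : Pair) : Lin fun x => Pf p q s t x a b c d := by
  intro x; simp only [Pf, Palg, Tf, Sf, Gf, tf, tracePart]; ring

theorem lin_Pf_two (p q : ℝ) (s t a b c d : Pair) : Lin fun x => Pf p q s t a x b c d := by
  intro x; simp only [Pf, Palg, Tf, Sf, Gf, tf, tracePart]; ring

theorem lin_Pf_five (p q : ℝ) (s t a b c d : Pair) : Lin fun x => Pf p q s t a b c d x := by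
  intro x; simp only [Pf, Palg, Tf, Sf, Gf, tf, tracePart]; ring

theorem bil_Pf_four_three (p q : ℝ) (s t a b d : Pair) :
    Bil fun x z => Pf p q s t a b z x d := by
  intro x z; simp only [Pf, Palg, Tf, Sf, Gf, tf, tracePart]; ring

namespace FrameData

variable {g : Comp 2} {T S : Comp 3} {τ : Comp 2} {y : Plane} {p q : ℝ} {E : Fin 2 → Pair}
  {s t u : Pair} {ds dt du : Pair × Pair} {κ : ℝ}

theorem rawTau_eq (h : FrameData g T S τ y p q E s t u ds dt du κ) (i j : Fin 2) :
    rawTau g T y i j = Cf p q (tauPar p q s t ds dt) (E i) (E j) := by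
  have c1 := h.contract (Φ := fun a b => Lf p q (lin2 ds b) (lin2 dt b) (E i) (E j) a)
    (by intro a b; simp only [Lf, Lalg, Tf, Sf, Gf, tf, tracePart, lin2]; ring)
  have c2 := h.contract (Φ := fun a b => Lf p q (lin2 ds (E i)) (lin2 dt (E i)) a (E j) b)
    (by intro a b; simp only [Lf, Lalg, Tf, Sf, Gf, tf, tracePart, lin2]; ring)
  have c3 := h.contract_three
    (Φ := fun a b c a' b' c' => Lf p q s t (E i) a b * Pf p q s t a' b' c' c (E j))
    (fun b c b' c' => (lin_Lf_two p q s t (E i) b).mul (lin_Pf_one p q s t b' c' c (E j)))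
    (fun a c a' c' => (lin_Lf_three p q s t (E i) a).mul (lin_Pf_two p q s t a' c' c (E j)))
    (fun a b a' b' => (bil_Pf_four_three p q s t a' b' (E j)).const_mul (Lf p q s t (E i) a b))
  have c4 := h.contract_three
    (Φ := fun a b c a' b' c' => Lf p q s t c' a' b' * Pf p q s t a b (E i) (E j) c)
    (fun b c b' c' => (lin_Lf_two p q s t c' b').mul' (lin_Pf_one p q s t b (E i) (E j) c))
    (fun a c a' c' => (lin_Lf_three p q s t c' a').mul' (lin_Pf_two p q s t a (E i) (E j) c))
    (fun a b a' b' => (lin_Lf_one p q s t a' b').mul' (lin_Pf_five p q s t a b (E i) (E j)))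
  have e1 := raw_linear h.hp h.hq ds dt (E i) (E j)
  have e2 := raw_quadratic h.hp h.hq s t (E i) (E j) _ rfl
  have e3 : Cf p q (tauPar p q s t ds dt) (E i) (E j)
      = Cf p q (tauPar p q 0 0 ds dt) (E i) (E j) + Cf p q (tauPar p q s t 0 0) (E i) (E j) := by
    simp only [Cf, tauPar, Prod.fst_zero, Prod.snd_zero]; ring
  simp only [rawTau, h.dL_eq, h.L_eq, h.P_eq]
  simp only [← mul_assoc] at c3 c4
  rw [c1, c2, c3, c4, e3, ← e1, ← e2]
  ring

/-- When the trace of `T` is closed, its covariant derivative is symmetric, and the trace-free part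
in the formula for `τ` is the expression prescribed by the system for `C`. -/
theorem condTau_iff (h : FrameData g T S τ y p q E s t u ds dt du κ)
    (hcl : dt.1.2 - dt.2.1 = 0) :
    CondTau g S (tForm g T) τ y ↔ ∀ i j, τ y ![i, j] = rawTau g T y i j := by
  have hX : ∀ i j, (∑ a, ∑ b, gInv g y a b * S y ![i, j, a] * tForm g T y ![b])
      = p * (Sf p q s (E i) (E j) (1, 0) * t.1) + q * (Sf p q s (E i) (E j) (0, 1) * t.2) := by
    intro i j
    have := h.contract (Φ := fun a b => Sf p q s (E i) (E j) a * tf t b)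
      (by intro a b; simp only [Sf, tf]; ring)
    simp only [← mul_assoc] at this
    simp only [h.S_eq, h.t_eq, this]
    simp only [tf]; ring
  have hY : ∀ i j, (∑ a, ∑ b, gInv g y a b * cov g S y ![i, j, a, b])
      = p * Sf p q (lin2 ds (1, 0)) (E i) (E j) (1, 0)
        + q * Sf p q (lin2 ds (0, 1)) (E i) (E j) (0, 1) := by
    intro i j
    simp only [h.dS_eq]
    exact h.contract (Φ := fun a b => Sf p q (lin2 ds b) (E i) (E j) a)
      (by intro a b; simp only [Sf, lin2, tf]; ring)
  have main : ∀ i j, tfPart g y (fun i j =>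
    (2 / 3) * cov g (tForm g T) y ![i, j]
      - (4 / 9) * (∑ a, ∑ b, gInv g y a b * S y ![i, j, a] * tForm g T y ![b])
      - (8 / 9) * tForm g T y ![i] * tForm g T y ![j]
      + (1 / 3) * ∑ a, ∑ b, gInv g y a b * cov g S y ![i, j, a, b]) i j
      = Cf p q (tauPar p q s t ds dt) (E i) (E j) := by
    intro i j
    have hZ := h.contract (Φ := fun i j => (2 / 3) * tf (lin2 dt j) i
      - (4 / 9) * (p * (Sf p q s i j (1, 0) * t.1) + q * (Sf p q s i j (0, 1) * t.2))
      - (8 / 9) * tf t i * tf t j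
      + (1 / 3) * (p * Sf p q (lin2 ds (1, 0)) i j (1, 0)
        + q * Sf p q (lin2 ds (0, 1)) i j (0, 1)))
      (by intro a b; simp only [Sf, lin2, tf]; ring)
    simp only [tfPart, hX, hY]
    simp only [h.dt_eq, h.t_eq, hZ, h.met]
    have hcl' : dt.1.2 = dt.2.1 := by linarith
    simp only [Sf, lin2, tf, Cf, tauPar, hcl']
    rcases h.hp with rfl | rfl <;> rcases h.hq with rfl | rfl <;> ring
  unfold CondTau
  simp only [main, h.rawTau_eq]

theorem condLap_iff (h : FrameData g T S τ y p q E s t u ds dt du κ) :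
    CondLap g S (tForm g T) y ↔
      p * dt.1.1 + q * dt.2.2 - 4 / 3 * (p * s.1 ^ 2 + q * s.2 ^ 2) - 3 * κ = 0 := by
  have c1 := h.contract (Φ := fun a b => tf (lin2 dt b) a)
    (by intro a b; simp only [lin2, tf]; ring)
  have c2 := h.contract_three
    (Φ := fun a b c a' b' c' => Sf p q s a b c * Sf p q s a' b' c')
    (by intro _ _ _ _ a b; simp only [Sf]; ring)
    (by intro _ _ _ _ a b; simp only [Sf]; ring)
    (by intro _ _ _ _ a b; simp only [Sf]; ring)
  simp only [← mul_assoc] at c2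
  unfold CondLap
  simp only [h.dt_eq, h.S_eq, c1, c2, h.scal_eq]
  simp only [Sf, lin2, tf]
  rw [← sub_eq_zero]
  apply Eq.congr_left
  rcases h.hp with rfl | rfl <;> rcases h.hq with rfl | rfl <;> ring

end FrameData

/-- The totally symmetric trace-free tensor of rank four with `W₁₁₁₁ = w.1`, `W₁₁₁₂ = w.2`. -/
def Wf (p q : ℝ) (w : Pair) (x y z v : Pair) : ℝ :=
  w.1 * (x.1 * y.1 * z.1 * v.1 + x.2 * y.2 * z.2 * v.2
      - p * q * (x.1 * y.1 * z.2 * v.2 + x.1 * y.2 * z.1 * v.2 + x.1 * y.2 * z.2 * v.1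
        + x.2 * y.1 * z.1 * v.2 + x.2 * y.1 * z.2 * v.1 + x.2 * y.2 * z.1 * v.1))
    + w.2 * (x.1 * y.1 * z.1 * v.2 + x.1 * y.1 * z.2 * v.1 + x.1 * y.2 * z.1 * v.1
        + x.2 * y.1 * z.1 * v.1
      - p * q * (x.1 * y.2 * z.2 * v.2 + x.2 * y.1 * z.2 * v.2 + x.2 * y.2 * z.1 * v.2
        + x.2 * y.2 * z.2 * v.1))

/-- The symmetric trace-free part of a tensor of rank four that is symmetric and trace-free in its
first three slots. -/
theorem symTF4_eq {g : Comp 2} {y : Plane} {p q : ℝ} {E : Fin 2 → Pair} (h : IsFrame g y p q E)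
    {X : (Fin 4 → Fin 2) → ℝ} {z : Pair × Pair}
    (hX : ∀ i j k l, X ![i, j, k, l] = Sf p q (lin2 z (E l)) (E i) (E j) (E k)) (i j k l : Fin 2) :
    symTF4 g y X i j k l = 12 * Wf p q (z.1.1 - p * q * z.2.2, z.1.2 + z.2.1)
      (E i) (E j) (E k) (E l) := by
  let F : Pair → Pair → Pair → Pair → ℝ := fun i j k l =>
    6 * (Sf p q (lin2 z l) i j k + Sf p q (lin2 z k) i j l + Sf p q (lin2 z j) i k l
      + Sf p q (lin2 z i) j k l)
  have hY : ∀ i j k l, sym4 X ![i, j, k, l] = F (E i) (E j) (E k) (E l) := by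
    intro i j k l
    rw [sym4_eq]
    simp only [hX, F]
    simp only [Sf]
    ring
  let F2 : Pair → Pair → ℝ := fun k l =>
    p * F (1, 0) (1, 0) k l + q * F (0, 1) (0, 1) k l
  have hY2 : ∀ k l, tr4 g y (sym4 X) k l = F2 (E k) (E l) := by
    intro k l
    simp only [tr4, hY]
    exact h.contract (Φ := fun a b => F a b (E k) (E l))
      (by intro a b; simp only [F, Sf, lin2, tf]; ring)
  have hY0 := h.contract (Φ := F2) (by intro a b; simp only [F2, F, Sf, lin2, tf]; ring)
  simp only [symTF4, hY, hY2, hY0, h.met]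
  simp only [F2, F, Sf, lin2, tf, Wf]
  rcases h.hp with rfl | rfl <;> rcases h.hq with rfl | rfl <;> ring

theorem IsFrame.Wf_eq_zero {g : Comp 2} {y : Plane} {p q : ℝ} {E : Fin 2 → Pair}
    (h : IsFrame g y p q E) {w : Pair} (hw : ∀ i j k l, Wf p q w (E i) (E j) (E k) (E l) = 0) :
    w = 0 := by
  have h1 : ∀ x y z v, Wf p q w x y z v = 0 := by
    intro x y z v
    refine zero_of_lin h (Φ := fun x => Wf p q w x y z v) (by intro x; simp only [Wf]; ring)
      (fun i => ?_) x
    refine zero_of_lin h (Φ := fun x => Wf p q w (E i) x z v) (by intro x; simp only [Wf]; ring)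
      (fun j => ?_) y
    refine zero_of_lin h (Φ := fun x => Wf p q w (E i) (E j) x v)
      (by intro x; simp only [Wf]; ring) (fun k => ?_) z
    refine zero_of_lin h (Φ := fun x => Wf p q w (E i) (E j) (E k) x)
      (by intro x; simp only [Wf]; ring) (fun l => ?_) v
    exact hw i j k l
  have e1 := h1 (1, 0) (1, 0) (1, 0) (1, 0)
  have e2 := h1 (1, 0) (1, 0) (1, 0) (0, 1)
  simp [Wf] at e1 e2
  exact Prod.ext e1 e2

theorem FrameData.condDS_iff {g : Comp 2} {T S : Comp 3} {τ : Comp 2} {y : Plane} {p q : ℝ}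
    {E : Fin 2 → Pair} {s t u : Pair} {ds dt du : Pair × Pair} {κ : ℝ}
    (h : FrameData g T S τ y p q E s t u ds dt du κ) :
    CondDS g S (tForm g T) y ↔
      ds.1.1 - p * q * ds.2.2 - 4 / 3 * (s.1 * t.1 - p * q * s.2 * t.2) = 0 ∧
      ds.1.2 + ds.2.1 - 4 / 3 * (s.1 * t.2 + s.2 * t.1) = 0 := by
  have e1 := symTF4_eq h.toIsFrame (X := fun I => cov g S y I) h.dS_eq
  have e2 := symTF4_eq h.toIsFrame (X := fun I => S y ![I 0, I 1, I 2] * tForm g T y ![I 3])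
    (z := ((s.1 * t.1, s.1 * t.2), (s.2 * t.1, s.2 * t.2))) (by
      intro i j k l
      show S y ![i, j, k] * tForm g T y ![l] = _
      rw [h.S_eq, h.t_eq]
      simp only [Sf, lin2, tf]; ring)
  have e3 : ∀ i j k l, symTF4 g y (fun I => cov g S y I) i j k l -
      (4 / 3) * symTF4 g y (fun I => S y ![I 0, I 1, I 2] * tForm g T y ![I 3]) i j k l
      = 12 * Wf p q (ds.1.1 - p * q * ds.2.2 - 4 / 3 * (s.1 * t.1 - p * q * s.2 * t.2),
        ds.1.2 + ds.2.1 - 4 / 3 * (s.1 * t.2 + s.2 * t.1)) (E i) (E j) (E k) (E l) := by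
    intro i j k l
    rw [e1, e2]
    simp only [Wf]; ring
  constructor
  · intro H
    have := h.toIsFrame.Wf_eq_zero fun i j k l => by
      have := e3 i j k l
      rw [H i j k l, sub_self] at this
      exact (mul_eq_zero.1 this.symm).resolve_left (by norm_num)
    exact ⟨congrArg Prod.fst this, congrArg Prod.snd this⟩
  · rintro ⟨h1, h2⟩ i j k l
    rw [← sub_eq_zero, e3, h1, h2]
    simp [Wf]

/-! ### The integrability conditions of the system for `V` -/

/-- The contraction `g^{ab} Φ_a Ψ_b` of two covectors in an orthonormal frame. -/
def upf (p q : ℝ) (Φ Ψ : Pair → ℝ) : ℝ :=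
  p * (Φ (1, 0) * Ψ (1, 0)) + q * (Φ (0, 1) * Ψ (0, 1))

/-- `Q_{ijkm}` in an orthonormal frame. -/
def Qf (p q : ℝ) (s t u : Pair) (ds dt : Pair × Pair) (κ : ℝ) (i j k m : Pair) : ℝ :=
  Tf p q (lin2 ds k) (lin2 dt k) i j m + upf p q (Tf p q s t i j) (fun l => Tf p q s t l k m)
    - κ * (Gf p q j m * Gf p q k i - Gf p q j k * Gf p q m i) + Cf p q u i j * Gf p q k m

/-- `q_{jm}` in an orthonormal frame. -/
def qf (p q : ℝ) (s t u : Pair) (ds dt : Pair × Pair) (κ : ℝ) (j m : Pair) : ℝ :=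
  p * Qf p q s t u ds dt κ (1, 0) j (1, 0) m + q * Qf p q s t u ds dt κ (0, 1) j (0, 1) m

/-- `Γ_{ijk}` in an orthonormal frame. -/
def Gammaf (p q : ℝ) (s t u : Pair) (du : Pair × Pair) (i j k : Pair) : ℝ :=
  Cf p q (lin2 du k) i j + upf p q (Tf p q s t i j) (fun a => Cf p q u a k)

/-- `γ_k` in an orthonormal frame. -/
def gamf (p q : ℝ) (s t u : Pair) (du : Pair × Pair) (k : Pair) : ℝ :=
  p * Gammaf p q s t u du (1, 0) k (1, 0) + q * Gammaf p q s t u du (0, 1) k (0, 1)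

/-- `V_{,ij}` in an orthonormal frame. -/
def hessf (p q : ℝ) (s t u w : Pair) (v L : ℝ) (i j : Pair) : ℝ :=
  upf p q (Tf p q s t i j) (tf w) + Cf p q u i j * v + 1 / 2 * Gf p q i j * L

/-- `V_{,ijk}` in an orthonormal frame. -/
def thirdf (p q : ℝ) (s t u w : Pair) (ds dt du : Pair × Pair) (κ v L : ℝ) (i j k : Pair) : ℝ :=
  upf p q (Tf p q (lin2 ds k) (lin2 dt k) i j) (tf w)
    + upf p q (Tf p q s t i j) (fun m => hessf p q s t u w v L m k)
    + (Cf p q (lin2 du k) i j * v + Cf p q u i j * tf w k)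
    + 1 / 2 * Gf p q i j * (2 * upf p q (qf p q s t u ds dt κ k) (tf w)
      + 2 * gamf p q s t u du k * v + 2 * tf t k * L)

/-- The algebraic identity behind the first Ricci identity of the system for `V`: the second
equation of the system is its trace, and in dimension two it has no further components. -/
theorem thirdf_symm {p q : ℝ} (hp : p = 1 ∨ p = -1) (hq : q = 1 ∨ q = -1) (s t u w : Pair)
    (ds dt du : Pair × Pair) (κ v L : ℝ) (i j k : Pair) :
    thirdf p q s t u w ds dt du κ v L i j k - thirdf p q s t u w ds dt du κ v L i k j
      = κ * (Gf p q i k * tf w j - Gf p q i j * tf w k) := by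
  simp only [thirdf, hessf, gamf, Gammaf, qf, Qf, upf, Tf, Sf, Gf, Cf, lin2, tf, tracePart]
  rcases hp with rfl | rfl <;> rcases hq with rfl | rfl <;> ring

/-- The antisymmetric part of `q` is the exterior derivative of the trace form of `T`. -/
theorem qf_symm {p q : ℝ} (hp : p = 1 ∨ p = -1) (hq : q = 1 ∨ q = -1) (s t u : Pair)
    (ds dt : Pair × Pair) (κ : ℝ) (k l : Pair) :
    qf p q s t u ds dt κ k l - qf p q s t u ds dt κ l k
      = 2 * (tf (lin2 dt l) k - tf (lin2 dt k) l) := by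
  simp only [qf, Qf, upf, Tf, Sf, Gf, Cf, lin2, tf, tracePart]
  rcases hp with rfl | rfl <;> rcases hq with rfl | rfl <;> ring

theorem lin_Tf_one (p q : ℝ) (s t a b : Pair) : Lin (fun x => Tf p q s t x a b) := by
  intro x; simp only [Tf, Sf, Gf, tf, tracePart]; ring

theorem lin_Tf_three (p q : ℝ) (s t a b : Pair) : Lin (Tf p q s t a b) := by
  intro x; simp only [Tf, Sf, Gf, tf, tracePart]; ring

theorem lin_qf (p q : ℝ) (s t u : Pair) (ds dt : Pair × Pair) (κ : ℝ) (k : Pair) :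
    Lin (qf p q s t u ds dt κ k) := by
  intro x; simp only [qf, Qf, upf, Tf, Sf, Gf, Cf, tf, tracePart]; ring

theorem lin_hessf (p q : ℝ) (s t u w : Pair) (v L : ℝ) (k : Pair) :
    Lin (fun m => hessf p q s t u w v L m k) := by
  intro x; simp only [hessf, upf, Tf, Sf, Gf, Cf, tf, tracePart]; ring

namespace FrameData

variable {g : Comp 2} {T S : Comp 3} {τ : Comp 2} {y : Plane} {p q : ℝ} {E : Fin 2 → Pair}
  {s t u : Pair} {ds dt du : Pair × Pair} {κ : ℝ}

theorem Tup_contract (h : FrameData g T S τ y p q E s t u ds dt du κ) {Ψ : Pair → ℝ}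
    (hΨ : Lin Ψ) (i j : Fin 2) :
    ∑ m, Tup g T y i j m * Ψ (E m) = upf p q (Tf p q s t (E i) (E j)) Ψ := by
  simp only [Tup, h.T_eq]
  exact h.contract_up (lin_Tf_three p q s t (E i) (E j)) hΨ

theorem Qten_eq (h : FrameData g T S τ y p q E s t u ds dt du κ) (i j k m : Fin 2) :
    Qten g T τ y i j k m = Qf p q s t u ds dt κ (E i) (E j) (E k) (E m) := by
  have hR : riemLow g y i j k m
      = κ * (Gf p q (E j) (E m) * Gf p q (E k) (E i)
        - Gf p q (E j) (E k) * Gf p q (E m) (E i)) := by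
    have := h.riem_eq j k m (fun n => g y ![i, n])
    simp only [riemLow, mul_comm (g y _)]
    rw [this]
    simp only [h.met, Gf]; ring
  simp only [Qten, h.dT_eq, hR, h.τ_eq, h.T_eq, h.met]
  rw [h.Tup_contract (lin_Tf_one p q s t (E k) (E m))]
  rfl

theorem qten_eq (h : FrameData g T S τ y p q E s t u ds dt du κ) (j m : Fin 2) :
    qten g T τ y ![j, m] = qf p q s t u ds dt κ (E j) (E m) := by
  simp only [qten, h.Qten_eq]
  exact h.contract (Φ := fun i k => Qf p q s t u ds dt κ i (E j) k (E m)) (by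
    intro x z; simp only [Qf, upf, Tf, Sf, Gf, Cf, lin2, tf, tracePart]; ring)

theorem gam_eq (h : FrameData g T S τ y p q E s t u ds dt du κ) (k : Fin 2) :
    gam g T τ y ![k] = gamf p q s t u du (E k) := by
  have hG : ∀ i j k, Gten g T τ y i j k = Gammaf p q s t u du (E i) (E j) (E k) := by
    intro i j k
    simp only [Gten, h.dτ_eq, h.τ_eq]
    rw [h.Tup_contract (Ψ := fun a => Cf p q u a (E k)) (by intro x; simp only [Cf]; ring)]
    rfl
  simp only [gam, hG]
  exact h.contract (Φ := fun i j => Gammaf p q s t u du i (E k) j) (by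
    intro x z; simp only [Gammaf, upf, Tf, Sf, Gf, Cf, lin2, tf, tracePart]; ring)

theorem qup_contract (h : FrameData g T S τ y p q E s t u ds dt du κ) {Ψ : Pair → ℝ}
    (hΨ : Lin Ψ) (k : Fin 2) :
    ∑ m, qup g T τ y k m * Ψ (E m) = upf p q (qf p q s t u ds dt κ (E k)) Ψ := by
  simp only [qup, h.qten_eq]
  exact h.contract_up (lin_qf p q s t u ds dt κ (E k)) hΨ

theorem hessV_eq (h : FrameData g T S τ y p q E s t u ds dt du κ) (v L : ℝ) {w : Fin 2 → ℝ}
    {w' : Pair} (hw : ∀ i, w i = tf w' (E i)) (i j : Fin 2) :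
    hessV g T τ y v w L i j = hessf p q s t u w' v L (E i) (E j) := by
  simp only [hessV, hw, h.τ_eq, h.met]
  rw [h.Tup_contract (lin_tf w')]
  rfl

theorem thirdV_eq (h : FrameData g T S τ y p q E s t u ds dt du κ) (v L : ℝ) {w : Fin 2 → ℝ}
    {w' : Pair} (hw : ∀ i, w i = tf w' (E i)) (i j k : Fin 2) :
    thirdV g T τ y v w L i j k
      = thirdf p q s t u w' ds dt du κ v L (E i) (E j) (E k) := by
  simp only [thirdV, dLapV, h.hessV_eq v L hw, hw, h.τ_eq, h.dτ_eq, h.dT_eq, h.met, h.gam_eq,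
    h.t_eq, Finset.sum_add_distrib]
  rw [h.Tup_contract (lin_hessf p q s t u w' v L (E k)), h.qup_contract (lin_tf w'),
    h.contract_up (lin_Tf_three p q _ _ (E i) (E j)) (lin_tf w')]
  rfl

/-- The first Ricci identity of the system for `V` holds automatically in dimension two. -/
theorem thirdV_symm (h : FrameData g T S τ y p q E s t u ds dt du κ) (v L : ℝ) (w : Fin 2 → ℝ)
    (i j k : Fin 2) :
    thirdV g T τ y v w L i j k - thirdV g T τ y v w L i k j = ∑ m, riem g y m i j k * w m := by
  obtain ⟨A, B, hw⟩ := h.exists_comp w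
  have hw' : ∀ i, w i = tf (A, B) (E i) := by
    intro i; rw [hw]; simp only [tf]; ring
  rw [h.thirdV_eq v L hw', h.thirdV_eq v L hw', thirdf_symm h.hp h.hq, h.riem_eq, hw', hw',
    h.met, h.met]
  rfl

theorem qup_lower (h : FrameData g T S τ y p q E s t u ds dt du κ) (k l : Fin 2) :
    ∑ m, qup g T τ y k m * g y ![m, l] = qten g T τ y ![k, l] := by
  have := h.qup_contract (Ψ := fun x => Gf p q x (E l)) (by intro x; simp only [Gf]; ring) k
  simp only [h.met, h.qten_eq]
  refine this.trans ?_
  rw [lin_qf p q s t u ds dt κ (E k) (E l)]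
  simp only [upf, Gf]
  rcases h.hp with rfl | rfl <;> rcases h.hq with rfl | rfl <;> ring

theorem closed_iff (h : FrameData g T S τ y p q E s t u ds dt du κ) :
    (∀ k l, cov g (tForm g T) y ![k, l] = cov g (tForm g T) y ![l, k]) ↔ dt.1.2 - dt.2.1 = 0 := by
  have key : ∀ k l, cov g (tForm g T) y ![k, l] - cov g (tForm g T) y ![l, k]
      = ((E k).1 * (E l).2 - (E k).2 * (E l).1) * (dt.1.2 - dt.2.1) := by
    intro k l
    simp only [h.dt_eq, tf, lin2]; ring
  constructor
  · intro H
    have := key 0 1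
    rw [H 0 1, sub_self, eq_comm] at this
    exact (mul_eq_zero.1 this).resolve_left h.indep
  · intro H k l
    rw [← sub_eq_zero, key, H, mul_zero]

/-- The Ricci identity of `ΔV`, sorted by the values of `V`, `V_{,m}` and `ΔV`. -/
theorem ricciV_iff (h : FrameData g T S τ y p q E s t u ds dt du κ) :
    RicciV g T τ y ↔ (∀ k l, cov g (tForm g T) y ![k, l] = cov g (tForm g T) y ![l, k]) ∧
      CondQ g T τ (tForm g T) y ∧ CondGamma g T τ (tForm g T) y := by
  let A := fun k l n : Fin 2 =>
    (∑ r, gInv g y n r * cov g (qten g T τ) y ![k, r, l])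
      + (∑ m, Tup g T y m l n * qup g T τ y k m)
      + 2 * tForm g T y ![k] * qup g T τ y l n
      + gam g T τ y ![k] * (if l = n then 1 else 0)
  let B := fun i j : Fin 2 =>
    cov g (gam g T τ) y ![i, j] + (∑ m, qup g T τ y i m * τ y ![m, j])
      + 2 * tForm g T y ![i] * gam g T τ y ![j]
  have key : ∀ (v : ℝ) (w : Fin 2 → ℝ) (L : ℝ) (k l : Fin 2), hessLapV g T τ y v w L k l
      = 2 * (∑ n, A k l n * w n) + 2 * v * B k l
        + L * ((∑ m, qup g T τ y k m * g y ![m, l]) + 2 * cov g (tForm g T) y ![k, l]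
          + 4 * tForm g T y ![k] * tForm g T y ![l]) := by
    intro v w L k l
    simp only [hessLapV, hessV, dLapV, A, B, Fin.sum_univ_two]
    fin_cases l <;> simp <;> ring
  have hL : ∀ k l, qten g T τ y ![k, l] - qten g T τ y ![l, k]
      = 2 * (cov g (tForm g T) y ![k, l] - cov g (tForm g T) y ![l, k]) := by
    intro k l
    simp only [h.qten_eq, h.dt_eq]
    exact qf_symm h.hp h.hq s t u ds dt κ (E k) (E l)
  simp only [h.qup_lower] at key
  constructor
  · intro H
    refine ⟨fun k l => ?_, fun k l n => ?_, fun k l => ?_⟩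
    · have := (H 0 0 1).2 k l
      rw [key, key] at this
      simp only [Pi.zero_apply, mul_zero, Finset.sum_const_zero] at this
      linarith [hL k l]
    · have := (H 0 (Pi.single n 1) 0).2 k l
      rw [key, key] at this
      simp [Pi.single_apply] at this
      exact sub_eq_zero.2 this
    · have := (H 1 0 0).2 k l
      rw [key, key] at this
      simp at this
      exact sub_eq_zero.2 this
  · rintro ⟨hc, hQ, hG⟩ v w L
    refine ⟨h.thirdV_symm v L w, fun k l => ?_⟩
    have hA : ∀ n, A k l n = A l k n := fun n => sub_eq_zero.1 (hQ k l n)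
    have hB : B k l = B l k := sub_eq_zero.1 (hG k l)
    rw [key, key, hB]
    simp only [hA]
    have := hL k l
    rw [hc k l, sub_self, mul_zero, sub_eq_zero] at this
    rw [hc k l, this]
    ring

/-- The integrability conditions at a point, in terms of the structural conditions. -/
theorem integrability_iff (h : FrameData g T S τ y p q E s t u ds dt du κ) :
    ((∀ i j, τ y ![i, j] = rawTau g T y i j) ∧ RicciV g T τ y ∧ RicciC g T y) ↔
    (∀ k l, cov g (tForm g T) y ![k, l] = cov g (tForm g T) y ![l, k]) ∧
      CondLap g S (tForm g T) y ∧ CondDS g S (tForm g T) y ∧ CondTau g S (tForm g T) τ y ∧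
      CondQ g T τ (tForm g T) y ∧ CondGamma g T τ (tForm g T) y := by
  have hτ := h.condTau_iff
  rw [h.ricciV_iff, h.ricciC_iff, h.condLap_iff, h.condDS_iff, h.closed_iff]
  tauto

end FrameData

/-! ### Partial and covariant derivatives -/

open Filter Topology

/-- All components of `A` are smooth near `y`. -/
def SmoothAt {k : ℕ} (A : Comp k) (y : Plane) : Prop :=
  ∀ I, ContDiffAt ℝ ∞ (fun z => A z I) y

section pd

variable {f h : Plane → ℝ} {y : Plane}

theorem pd_add (i : Fin 2) (hf : DifferentiableAt ℝ f y) (hh : DifferentiableAt ℝ h y) :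
    pd i (fun z => f z + h z) y = pd i f y + pd i h y := by
  simp only [pd]; rw [fderiv_fun_add hf hh]; rfl

theorem pd_sub (i : Fin 2) (hf : DifferentiableAt ℝ f y) (hh : DifferentiableAt ℝ h y) :
    pd i (fun z => f z - h z) y = pd i f y - pd i h y := by
  simp only [pd]; rw [fderiv_fun_sub hf hh]; rfl

theorem pd_mul (i : Fin 2) (hf : DifferentiableAt ℝ f y) (hh : DifferentiableAt ℝ h y) :
    pd i (fun z => f z * h z) y = f y * pd i h y + h y * pd i f y := by
  simp only [pd]; rw [fderiv_fun_mul hf hh]; rfl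

theorem pd_const (i : Fin 2) (c : ℝ) : pd i (fun _ => c) y = 0 := by
  simp [pd]

theorem pd_congr (i : Fin 2) (hfh : f =ᶠ[𝓝 y] h) : pd i f y = pd i h y := by
  simp only [pd, hfh.fderiv_eq]

theorem contDiffAt_pd (i : Fin 2) (hf : ContDiffAt ℝ ∞ f y) : ContDiffAt ℝ ∞ (pd i f) y := by
  have : ContDiffAt ℝ ∞ (fderiv ℝ f) y := hf.fderiv_right (by simp)
  exact this.clm_apply contDiffAt_const

theorem pd_comm (i j : Fin 2) (hf : ContDiffAt ℝ ∞ f y) : pd i (pd j f) y = pd j (pd i f) y := by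
  have hd : DifferentiableAt ℝ (fderiv ℝ f) y :=
    (hf.fderiv_right (m := ∞) (by simp)).differentiableAt (by simp)
  have hs := hf.isSymmSndFDerivAt (by simpa using WithTop.coe_le_coe.2 (le_top : (2 : ℕ∞) ≤ ⊤))
  have key : ∀ i j, pd i (pd j f) y
      = fderiv ℝ (fderiv ℝ f) y (EuclideanSpace.single i 1) (EuclideanSpace.single j 1) := by
    intro i j
    have : pd j f = fun z => (fderiv ℝ f z) (EuclideanSpace.single j 1) := rfl
    rw [this, pd, fderiv_clm_apply hd (differentiableAt_const _)]
    simp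
  rw [key, key, hs]

end pd

theorem SmoothAt.diff {k : ℕ} {A : Comp k} {y : Plane} (hA : SmoothAt A y) (I : Fin k → Fin 2) :
    DifferentiableAt ℝ (fun z => A z I) y := (hA I).differentiableAt (by simp)

section cov

variable (g : Comp 2) (y : Plane)

theorem cov_one (A : Comp 1) (i l : Fin 2) : cov g A y ![i, l] =
    pd l (fun z => A z ![i]) y - ∑ m, chris g y m l i * A y ![m] := by
  have e : ∀ m : Fin 2, Function.update ![i] 0 m
      = ![m] := by
    intro m; ext b; fin_cases b; rfl
  have e0 : (fun b : Fin 1 => (![i, l] : Fin 2 → Fin 2) b.castSucc) = ![i] := by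
    ext b; fin_cases b; rfl
  simp only [cov, e0, Fin.sum_univ_one, e]
  rfl

theorem cov_two (A : Comp 2) (i j l : Fin 2) : cov g A y ![i, j, l] =
    pd l (fun z => A z ![i, j]) y
      - ∑ m, (chris g y m l i * A y ![m, j] + chris g y m l j * A y ![i, m]) := by
  have e0 : (fun b : Fin 2 => (![i, j, l] : Fin 3 → Fin 2) b.castSucc) = ![i, j] := by
    ext b; fin_cases b <;> rfl
  have u0 : ∀ m : Fin 2, Function.update ![i, j] 0 m = ![m, j] := by
    intro m; ext b; fin_cases b <;> rfl
  have u1 : ∀ m : Fin 2, Function.update ![i, j] 1 m = ![i, m] := by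
    intro m; ext b; fin_cases b <;> rfl
  simp only [cov, e0, Fin.sum_univ_two, u0, u1]
  simp only [Fin.castSucc, Fin.last]
  simp
  ring

theorem cov_three (A : Comp 3) (i j k l : Fin 2) : cov g A y ![i, j, k, l] =
    pd l (fun z => A z ![i, j, k]) y
      - ∑ m, (chris g y m l i * A y ![m, j, k] + chris g y m l j * A y ![i, m, k]
        + chris g y m l k * A y ![i, j, m]) := by
  have e0 : (fun b : Fin 3 => (![i, j, k, l] : Fin 4 → Fin 2) b.castSucc) = ![i, j, k] := by
    ext b; fin_cases b <;> rfl
  have u0 : ∀ m : Fin 2, Function.update ![i, j, k] 0 m = ![m, j, k] := by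
    intro m; ext b; fin_cases b <;> rfl
  have u1 : ∀ m : Fin 2, Function.update ![i, j, k] 1 m = ![i, m, k] := by
    intro m; ext b; fin_cases b <;> rfl
  have u2 : ∀ m : Fin 2, Function.update ![i, j, k] 2 m = ![i, j, m] := by
    intro m; ext b; fin_cases b <;> rfl
  simp only [cov, e0, Fin.sum_univ_three, Fin.sum_univ_two, u0, u1, u2]
  simp only [Fin.castSucc, Fin.last]
  simp
  ring

theorem cov_five (A : Comp 5) (i j k r s l : Fin 2) : cov g A y ![i, j, k, r, s, l] =
    pd l (fun z => A z ![i, j, k, r, s]) y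
      - ∑ m, (chris g y m l i * A y ![m, j, k, r, s] + chris g y m l j * A y ![i, m, k, r, s]
        + chris g y m l k * A y ![i, j, m, r, s] + chris g y m l r * A y ![i, j, k, m, s]
        + chris g y m l s * A y ![i, j, k, r, m]) := by
  have e0 : (fun b : Fin 5 => (![i, j, k, r, s, l] : Fin 6 → Fin 2) b.castSucc)
      = ![i, j, k, r, s] := by
    ext b; fin_cases b <;> rfl
  have u0 : ∀ m : Fin 2, Function.update ![i, j, k, r, s] 0 m = ![m, j, k, r, s] := by
    intro m; ext b; fin_cases b <;> rfl
  have u1 : ∀ m : Fin 2, Function.update ![i, j, k, r, s] 1 m = ![i, m, k, r, s] := by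
    intro m; ext b; fin_cases b <;> rfl
  have u2 : ∀ m : Fin 2, Function.update ![i, j, k, r, s] 2 m = ![i, j, m, r, s] := by
    intro m; ext b; fin_cases b <;> rfl
  have u3 : ∀ m : Fin 2, Function.update ![i, j, k, r, s] 3 m = ![i, j, k, m, s] := by
    intro m; ext b; fin_cases b <;> rfl
  have u4 : ∀ m : Fin 2, Function.update ![i, j, k, r, s] 4 m = ![i, j, k, r, m] := by
    intro m; ext b; fin_cases b <;> rfl
  simp only [cov, e0, Fin.sum_univ_five, Fin.sum_univ_two, u0, u1, u2, u3, u4]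
  simp only [Fin.castSucc, Fin.last]
  simp
  ring

theorem cov_congr {k : ℕ} {A B : Comp k} (h : ∀ᶠ z in 𝓝 y, A z = B z) : cov g A y = cov g B y := by
  funext I
  have hy : A y = B y := h.self_of_nhds
  simp only [cov, hy]
  congr 1
  apply pd_congr
  filter_upwards [h] with z hz
  rw [hz]

end cov

/-- The components of a metric near the point `y`: smooth, symmetric, non-degenerate. -/
structure MetricAt (g : Comp 2) (y : Plane) : Prop where
  smooth : SmoothAt g y
  symm : ∀ᶠ z in 𝓝 y, ∀ i j, g z ![i, j] = g z ![j, i]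
  det : ∀ᶠ z in 𝓝 y, g z ![0, 0] * g z ![1, 1] - g z ![0, 1] * g z ![1, 0] ≠ 0

section metric

variable {g : Comp 2} {y : Plane}

theorem gInv_mul (hd : g y ![0, 0] * g y ![1, 1] - g y ![0, 1] * g y ![1, 0] ≠ 0) (a b : Fin 2) :
    ∑ m, gInv g y a m * g y ![m, b] = if a = b then 1 else 0 := by
  have hw := inv_mul_cancel₀ hd
  simp only [gInv_eq, Fin.sum_univ_two]
  generalize (g y ![0, 0] * g y ![1, 1] - g y ![0, 1] * g y ![1, 0])⁻¹ = w at *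
  fin_cases a <;> fin_cases b <;> simp <;> first | linear_combination hw | ring

theorem mul_gInv (hd : g y ![0, 0] * g y ![1, 1] - g y ![0, 1] * g y ![1, 0] ≠ 0) (a b : Fin 2) :
    ∑ m, g y ![a, m] * gInv g y m b = if a = b then 1 else 0 := by
  have hw := inv_mul_cancel₀ hd
  simp only [gInv_eq, Fin.sum_univ_two]
  generalize (g y ![0, 0] * g y ![1, 1] - g y ![0, 1] * g y ![1, 0])⁻¹ = w at *
  fin_cases a <;> fin_cases b <;> simp <;> first | linear_combination hw | ring

theorem chris_symm (hs : ∀ᶠ z in 𝓝 y, ∀ i j, g z ![i, j] = g z ![j, i]) (m i j : Fin 2) :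
    chris g y m i j = chris g y m j i := by
  have : ∀ l, pd l (fun z => g z ![i, j]) y = pd l (fun z => g z ![j, i]) y := by
    intro l
    apply pd_congr
    filter_upwards [hs] with z hz using hz i j
  simp only [chris, this]
  congr 1
  refine Finset.sum_congr rfl fun l _ => ?_
  ring

/-- Metric compatibility of the Levi-Civita connection. -/
theorem pd_metric (hs : ∀ᶠ z in 𝓝 y, ∀ i j, g z ![i, j] = g z ![j, i])
    (hd : g y ![0, 0] * g y ![1, 1] - g y ![0, 1] * g y ![1, 0] ≠ 0) (l i j : Fin 2) :
    pd l (fun z => g z ![i, j]) y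
      = ∑ m, (chris g y m l i * g y ![m, j] + chris g y m l j * g y ![i, m]) := by
  have hsy := hs.self_of_nhds
  have hp : ∀ l i j, pd l (fun z => g z ![i, j]) y = pd l (fun z => g z ![j, i]) y := by
    intro l i j
    apply pd_congr
    filter_upwards [hs] with z hz using hz i j
  have low : ∀ l i j, ∑ m, g y ![j, m] * chris g y m l i = 1 / 2 *
      (pd l (fun z => g z ![i, j]) y + pd i (fun z => g z ![l, j]) y
        - pd j (fun z => g z ![l, i]) y) := by
    intro l i j
    have e : ∀ X : Fin 2 → ℝ, ∑ m, g y ![j, m] * (1 / 2 * ∑ n, gInv g y m n * X n)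
        = 1 / 2 * ∑ n, (∑ m, g y ![j, m] * gInv g y m n) * X n := by
      intro X; simp only [Fin.sum_univ_two]; ring
    simp only [chris]
    rw [e (fun n => pd l (fun z => g z ![i, n]) y + pd i (fun z => g z ![l, n]) y
        - pd n (fun z => g z ![l, i]) y)]
    simp only [mul_gInv hd, ite_mul, one_mul, zero_mul, Finset.sum_ite_eq, Finset.mem_univ, if_true]
  have e1 := low l i j
  have e2 := low l j i
  rw [Finset.sum_add_distrib]
  have e3 : ∑ m, chris g y m l i * g y ![m, j] = ∑ m, g y ![j, m] * chris g y m l i :=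
    Finset.sum_congr rfl fun m _ => by rw [hsy m j, mul_comm]
  have e4 : ∑ m, chris g y m l j * g y ![i, m] = ∑ m, g y ![i, m] * chris g y m l j :=
    Finset.sum_congr rfl fun m _ => by rw [mul_comm]
  rw [e3, e4, e1, e2, hp l j i]
  ring

theorem contDiffAt_gInv (hg : MetricAt g y) (a b : Fin 2) :
    ContDiffAt ℝ ∞ (fun z => gInv g z a b) y := by
  have hs := hg.smooth
  have h0 := hg.det.self_of_nhds
  simp only [gInv_eq]
  refine ContDiffAt.mul (ContDiffAt.inv ?_ h0) ?_
  · exact ((hs _).mul (hs _)).sub ((hs _).mul (hs _))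
  · fin_cases a <;> fin_cases b <;> simp
    · exact hs _
    · exact (hs _).neg
    · exact (hs _).neg
    · exact hs _

theorem contDiffAt_chris (hg : MetricAt g y) (m i j : Fin 2) :
    ContDiffAt ℝ ∞ (fun z => chris g z m i j) y := by
  simp only [chris]
  refine contDiffAt_const.mul (ContDiffAt.sum fun l _ => (contDiffAt_gInv hg m l).mul ?_)
  exact ((contDiffAt_pd i (hg.smooth _)).add (contDiffAt_pd j (hg.smooth _))).sub
    (contDiffAt_pd l (hg.smooth _))

end metric

/-! ### Curvature of a surface, and covariant derivatives of the derived tensors -/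

section curvature

variable {g : Comp 2} {y : Plane}

/-- The curvature tensor is antisymmetric in its first two indices. -/
theorem riem_antisymm (hg : MetricAt g y) (a b j k : Fin 2) :
    ∑ m, (riem g y m a j k * g y ![m, b] + riem g y m b j k * g y ![a, m]) = 0 := by
  have hdiff : ∀ m i j, DifferentiableAt ℝ (fun z => chris g z m i j) y := fun m i j =>
    (contDiffAt_chris hg m i j).differentiableAt (by simp)
  have gdiff : ∀ i j, DifferentiableAt ℝ (fun z => g z ![i, j]) y := fun i j => hg.smooth.diff _
  have hsym := hg.symm.self_of_nhds
  have hdet := hg.det.self_of_nhds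
  have hΓ := chris_symm hg.symm
  -- first derivatives of the metric near `y`, with the Christoffel symbols ordered as in `riem`
  have first : ∀ k, ∀ᶠ z in 𝓝 y, pd k (fun z => g z ![a, b]) z
      = ∑ m, (chris g z m a k * g z ![m, b] + chris g z m b k * g z ![a, m]) := by
    intro k
    filter_upwards [hg.symm.eventually_nhds, hg.det] with z h1 h2
    rw [pd_metric h1 h2]
    simp only [chris_symm h1 _ k]
  have second : ∀ j k, pd j (pd k (fun z => g z ![a, b])) y
      = ∑ m, (pd j (fun z => chris g z m a k) y * g y ![m, b]
          + chris g y m a k * pd j (fun z => g z ![m, b]) y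
          + (pd j (fun z => chris g z m b k) y * g y ![a, m]
          + chris g y m b k * pd j (fun z => g z ![a, m]) y)) := by
    intro j k
    rw [pd_congr j (first k)]
    simp only [Fin.sum_univ_two]
    simp (disch := fun_prop) only [pd_add, pd_mul]
    ring
  have comm := pd_comm j k (hg.smooth ![a, b])
  rw [second, second] at comm
  simp only [pd_metric hg.symm hdet, Fin.sum_univ_two] at comm
  simp only [riem, Fin.sum_univ_two]
  have h10 : ∀ m, chris g y m 1 0 = chris g y m 0 1 := fun m => hΓ m 1 0
  have s10 : g y ![1, 0] = g y ![0, 1] := hsym 1 0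
  fin_cases a <;> fin_cases b <;> fin_cases j <;> fin_cases k <;>
    simp only [Fin.zero_eta, Fin.mk_one, Fin.isValue, h10, s10] at comm ⊢ <;>
    first | ring1 | linear_combination comm

/-- In dimension two the curvature tensor is determined by the scalar curvature. -/
theorem riem_eq_scal (hg : MetricAt g y) (i j k : Fin 2) (w : Fin 2 → ℝ) :
    ∑ m, riem g y m i j k * w m = scal g y / 2 * (g y ![i, k] * w j - g y ![i, j] * w k) := by
  have hdet := hg.det.self_of_nhds
  have hsym := hg.symm.self_of_nhds
  have s10 : g y ![1, 0] = g y ![0, 1] := hsym 1 0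
  obtain ⟨ρ, hρ⟩ : ∃ ρ, ∀ m i j k, riem g y m i j k
      = ρ * (g y ![i, k] * (if m = j then 1 else 0) - g y ![i, j] * (if m = k then 1 else 0)) := by
    have hw := inv_mul_cancel₀ hdet
    refine ⟨(g y ![0, 0] * g y ![1, 1] - g y ![0, 1] * g y ![1, 0])⁻¹ *
      ∑ m, g y ![0, m] * riem g y m 1 0 1, fun m i j k => ?_⟩
    have anti : ∀ m i j k, riem g y m i j k = - riem g y m i k j := by
      intro m i j k
      simp only [riem, Fin.sum_univ_two]; ring
    have diag : ∀ m i j, riem g y m i j j = 0 := by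
      intro m i j
      linarith [anti m i j j]
    have e00 := riem_antisymm hg 0 0 0 1
    have e01 := riem_antisymm hg 0 1 0 1
    have e11 := riem_antisymm hg 1 1 0 1
    simp only [Fin.sum_univ_two, s10] at e00 e01 e11 hw ⊢
    have main : ∀ m i, riem g y m i 0 1
        = (g y ![0, 0] * g y ![1, 1] - g y ![0, 1] * g y ![0, 1])⁻¹ *
          (g y ![0, 0] * riem g y 0 1 0 1 + g y ![0, 1] * riem g y 1 1 0 1)
          * (g y ![i, 1] * (if m = 0 then 1 else 0) - g y ![i, 0] * (if m = 1 then 1 else 0)) := by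
      generalize (g y ![0, 0] * g y ![1, 1] - g y ![0, 1] * g y ![0, 1])⁻¹ = w at *
      intro m i
      fin_cases m <;> fin_cases i <;> simp [s10]
      · linear_combination (-riem g y 0 0 0 1) * hw + w * g y ![1, 1] * e00 / 2
          - w * g y ![0, 1] * e01
      · linear_combination (-riem g y 0 1 0 1) * hw - w * g y ![0, 1] * e11 / 2
      · linear_combination (-riem g y 1 0 0 1) * hw - w * g y ![0, 1] * e00 / 2
          + w * g y ![0, 0] * e01
      · linear_combination (-riem g y 1 1 0 1) * hw + w * g y ![0, 0] * e11 / 2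
    fin_cases j <;> fin_cases k
    · simp [diag]
    · exact main m i
    · refine (anti m i 1 0).trans ?_
      rw [main]
      simp only [Fin.zero_eta, Fin.mk_one]
      ring
    · simp [diag]
  have hscal : scal g y = 2 * ρ := by
    have hw := inv_mul_cancel₀ hdet
    simp only [scal, hρ, gInv_eq, Fin.sum_univ_two]
    generalize (g y ![0, 0] * g y ![1, 1] - g y ![0, 1] * g y ![1, 0])⁻¹ = w at *
    simp only [s10] at hw ⊢
    simp
    linear_combination 2 * ρ * hw
  rw [hscal]
  simp only [hρ, Fin.sum_univ_two]
  fin_cases j <;> fin_cases k <;> simp <;> ring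

end curvature

section leibniz

variable {g : Comp 2} {T : Comp 3} {y : Plane}

theorem cov_Pten (hg : MetricAt g y) (hT : SmoothAt T y) (ht : SmoothAt (tForm g T) y)
    (i j k m n l : Fin 2) :
    cov g (Pten g T) y ![i, j, k, m, n, l] = Palg (fun i j => g y ![i, j])
      (fun i j k => cov g T y ![i, j, k, l]) (fun i => cov g (tForm g T) y ![i, l]) i j k m n := by
  have gdiff : ∀ i j, DifferentiableAt ℝ (fun z => g z ![i, j]) y := fun i j => hg.smooth.diff _
  have Tdiff : ∀ i j k, DifferentiableAt ℝ (fun z => T z ![i, j, k]) y := fun i j k => hT.diff _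
  have tdiff : ∀ i, DifferentiableAt ℝ (fun z => tForm g T z ![i]) y := fun i => ht.diff _
  have hdet := hg.det.self_of_nhds
  rw [cov_five]
  simp only [Pten_eq, Palg]
  simp (disch := fun_prop) only [pd_add, pd_sub, pd_mul, pd_const]
  simp only [pd_metric hg.symm hdet, cov_three, cov_one, Fin.sum_univ_two]
  ring

theorem cov_Lam (hg : MetricAt g y) (hT : SmoothAt T y) (ht : SmoothAt (tForm g T) y)
    (i j k l : Fin 2) :
    cov g (Lam g T) y ![i, j, k, l] = Lalg (fun i j => g y ![i, j])
      (fun i j k => cov g T y ![i, j, k, l]) (fun i => cov g (tForm g T) y ![i, l]) i j k := by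
  have gdiff : ∀ i j, DifferentiableAt ℝ (fun z => g z ![i, j]) y := fun i j => hg.smooth.diff _
  have Tdiff : ∀ i j k, DifferentiableAt ℝ (fun z => T z ![i, j, k]) y := fun i j k => hT.diff _
  have tdiff : ∀ i, DifferentiableAt ℝ (fun z => tForm g T z ![i]) y := fun i => ht.diff _
  have hdet := hg.det.self_of_nhds
  rw [cov_three]
  simp only [Lam_eq, Lalg]
  simp (disch := fun_prop) only [pd_add, pd_sub, pd_mul, pd_const]
  simp only [pd_metric hg.symm hdet, cov_three, cov_one, Fin.sum_univ_two]
  ring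

/-- `T` minus its trace terms; in dimension two this is the totally symmetric trace-free part of
`T`. -/
def Spart (g : Comp 2) (T : Comp 3) : Comp 3 := fun y I =>
  T y I - tracePart (fun i j => g y ![i, j]) (fun i => tForm g T y ![i]) (I 0) (I 1) (I 2)

theorem Spart_eq (g : Comp 2) (T : Comp 3) (y : Plane) (i j k : Fin 2) :
    Spart g T y ![i, j, k] = T y ![i, j, k]
      - tracePart (fun i j => g y ![i, j]) (fun i => tForm g T y ![i]) i j k := rfl

theorem cov_Spart (hg : MetricAt g y) (hT : SmoothAt T y) (ht : SmoothAt (tForm g T) y)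
    (i j k l : Fin 2) :
    cov g (Spart g T) y ![i, j, k, l] = cov g T y ![i, j, k, l] - tracePart (fun i j => g y ![i, j])
      (fun i => cov g (tForm g T) y ![i, l]) i j k := by
  have gdiff : ∀ i j, DifferentiableAt ℝ (fun z => g z ![i, j]) y := fun i j => hg.smooth.diff _
  have Tdiff : ∀ i j k, DifferentiableAt ℝ (fun z => T z ![i, j, k]) y := fun i j k => hT.diff _
  have tdiff : ∀ i, DifferentiableAt ℝ (fun z => tForm g T z ![i]) y := fun i => ht.diff _
  have hdet := hg.det.self_of_nhds
  rw [cov_three]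
  simp only [Spart_eq, tracePart]
  simp (disch := fun_prop) only [pd_add, pd_sub, pd_mul]
  simp only [pd_metric hg.symm hdet, cov_three, cov_one, Fin.sum_univ_two]
  ring

theorem smoothAt_tForm (hg : MetricAt g y) (hT : SmoothAt T y) : SmoothAt (tForm g T) y := by
  intro I
  simp only [tForm]
  exact contDiffAt_const.mul (ContDiffAt.sum fun a _ => ContDiffAt.sum fun b _ =>
    (contDiffAt_gInv hg a b).mul (hT _))

theorem smoothAt_Spart (hg : MetricAt g y) (hT : SmoothAt T y) : SmoothAt (Spart g T) y := by
  intro I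
  have ht := smoothAt_tForm hg hT
  simp only [Spart, tracePart]
  exact (hT _).sub ((((ht _).mul (hg.smooth _)).add ((ht _).mul (hg.smooth _))).sub
    ((hg.smooth _).mul (ht _)))

theorem trace_eq_zero_iff (hd : g y ![0, 0] * g y ![1, 1] - g y ![0, 1] * g y ![1, 0] ≠ 0)
    (X : Fin 2 → Fin 2 → ℝ) : ∑ a, ∑ b, gInv g y a b * X a b = 0 ↔
      g y ![1, 1] * X 0 0 - g y ![0, 1] * X 0 1 - g y ![1, 0] * X 1 0
        + g y ![0, 0] * X 1 1 = 0 := by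
  have : ∑ a, ∑ b, gInv g y a b * X a b
      = (g y ![0, 0] * g y ![1, 1] - g y ![0, 1] * g y ![1, 0])⁻¹ * (g y ![1, 1] * X 0 0
        - g y ![0, 1] * X 0 1 - g y ![1, 0] * X 1 0 + g y ![0, 0] * X 1 1) := by
    simp only [gInv_eq, Fin.sum_univ_two]
    simp
    ring
  rw [this, mul_eq_zero, or_iff_right (inv_ne_zero hd)]

/-- The covariant derivative preserves vanishing of the trace in the first two indices; the trace
is formed with the adjugate of `g`, a multiple of the inverse. -/
theorem trace_cov_three (hg : MetricAt g y) {A : Comp 3} (hA : SmoothAt A y)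
    (htr : ∀ᶠ z in 𝓝 y, ∀ k, ∑ a, ∑ b, gInv g z a b * A z ![a, b, k] = 0) (k l : Fin 2) :
    ∑ a, ∑ b, gInv g y a b * cov g A y ![a, b, k, l] = 0 := by
  have gdiff : ∀ i j, DifferentiableAt ℝ (fun z => g z ![i, j]) y := fun i j => hg.smooth.diff _
  have Adiff : ∀ i j k, DifferentiableAt ℝ (fun z => A z ![i, j, k]) y := fun i j k => hA.diff _
  have hdet := hg.det.self_of_nhds
  have h0 : ∀ᶠ z in 𝓝 y, ∀ k, g z ![1, 1] * A z ![0, 0, k] - g z ![0, 1] * A z ![0, 1, k]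
      - g z ![1, 0] * A z ![1, 0, k] + g z ![0, 0] * A z ![1, 1, k] = 0 := by
    filter_upwards [htr, hg.det] with z hz hd k
    exact (trace_eq_zero_iff hd fun a b => A z ![a, b, k]).1 (hz k)
  have h1 : pd l (fun z => g z ![1, 1] * A z ![0, 0, k] - g z ![0, 1] * A z ![0, 1, k]
      - g z ![1, 0] * A z ![1, 0, k] + g z ![0, 0] * A z ![1, 1, k]) y = 0 := by
    rw [pd_congr l (h := fun _ => (0 : ℝ)) (by filter_upwards [h0] with z hz using hz k)]
    simp [pd]
  have hk := h0.self_of_nhds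
  have hk0 := hk 0
  have hk1 := hk 1
  have hkk := hk k
  rw [trace_eq_zero_iff hdet fun a b => cov g A y ![a, b, k, l]]
  simp (disch := fun_prop) only [pd_add, pd_sub, pd_mul] at h1
  simp only [pd_metric hg.symm hdet, Fin.sum_univ_two] at h1
  simp only [cov_three, Fin.sum_univ_two]
  linear_combination h1 - 2 * (chris g y 0 l 0 + chris g y 1 l 1) * hkk - chris g y 0 l k * hk0
    - chris g y 1 l k * hk1

theorem trace_cov_two (hg : MetricAt g y) {A : Comp 2} (hA : SmoothAt A y)
    (htr : ∀ᶠ z in 𝓝 y, ∑ a, ∑ b, gInv g z a b * A z ![a, b] = 0) (l : Fin 2) :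
    ∑ a, ∑ b, gInv g y a b * cov g A y ![a, b, l] = 0 := by
  have gdiff : ∀ i j, DifferentiableAt ℝ (fun z => g z ![i, j]) y := fun i j => hg.smooth.diff _
  have Adiff : ∀ i j, DifferentiableAt ℝ (fun z => A z ![i, j]) y := fun i j => hA.diff _
  have hdet := hg.det.self_of_nhds
  have h0 : ∀ᶠ z in 𝓝 y, g z ![1, 1] * A z ![0, 0] - g z ![0, 1] * A z ![0, 1]
      - g z ![1, 0] * A z ![1, 0] + g z ![0, 0] * A z ![1, 1] = 0 := by
    filter_upwards [htr, hg.det] with z hz hd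
    exact (trace_eq_zero_iff hd fun a b => A z ![a, b]).1 hz
  have h1 : pd l (fun z => g z ![1, 1] * A z ![0, 0] - g z ![0, 1] * A z ![0, 1]
      - g z ![1, 0] * A z ![1, 0] + g z ![0, 0] * A z ![1, 1]) y = 0 := by
    rw [pd_congr l (h := fun _ => (0 : ℝ)) h0]
    simp [pd]
  have hk := h0.self_of_nhds
  rw [trace_eq_zero_iff hdet fun a b => cov g A y ![a, b, l]]
  simp (disch := fun_prop) only [pd_add, pd_sub, pd_mul] at h1
  simp only [pd_metric hg.symm hdet, Fin.sum_univ_two] at h1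
  simp only [cov_two, Fin.sum_univ_two]
  linear_combination h1 - 2 * (chris g y 0 l 0 + chris g y 1 l 1) * hk

end leibniz

/-! ### The integrability conditions at a point of a chart -/

section frame

variable {g : Comp 2} {y : Plane} {p q : ℝ} {E : Fin 2 → Pair}

/-- The space of tensors of rank three that are symmetric and trace-free in the first two slots is
four-dimensional, spanned by the totally symmetric trace-free ones and the trace terms. -/
theorem IsFrame.exists_eq_Tf (h : IsFrame g y p q E) {X : Fin 2 → Fin 2 → Fin 2 → ℝ}
    (hs : ∀ i j k, X i j k = X j i k) (ht : ∀ k, ∑ a, ∑ b, gInv g y a b * X a b k = 0) :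
    ∃ s t : Pair, ∀ i j k, X i j k = Tf p q s t (E i) (E j) (E k) := by
  choose c hc using fun k => h.exists_eq_Cf (c := fun i j => X i j k) (fun i j => hs i j k) (ht k)
  obtain ⟨A, B, hAB⟩ := h.exists_comp fun k => (c k).1
  obtain ⟨C, D, hCD⟩ := h.exists_comp fun k => (c k).2
  -- `X₁₁₁ = p A`, `X₁₁₂ = p B`, `X₁₂₁ = C`, `X₁₂₂ = D`
  refine ⟨((p * A - p * q * D) / 2, (p * B + C) / 2), ((A + q * D) / 2, (p * C - B) / 2),
    fun i j k => ?_⟩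
  have := hc k i j
  rw [this]
  simp only [Cf, hAB, hCD, Tf, Sf, tracePart, Gf, tf]
  rcases h.hp with rfl | rfl <;> rcases h.hq with rfl | rfl <;> ring

theorem IsFrame.trace_Tf (h : IsFrame g y p q E) (s t : Pair) (i : Fin 2) :
    ∑ a, ∑ b, gInv g y a b * Tf p q s t (E a) (E i) (E b) = 2 * tf t (E i) := by
  rw [h.contract (Φ := fun a b => Tf p q s t a (E i) b)
    (by intro a b; simp only [Tf, Sf, tracePart, Gf, tf]; ring)]
  simp only [Tf, Sf, tracePart, Gf, tf]
  rcases h.hp with rfl | rfl <;> rcases h.hq with rfl | rfl <;> ring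

theorem IsFrame.exists_eq_Sf (h : IsFrame g y p q E) {X : Fin 2 → Fin 2 → Fin 2 → ℝ}
    (hs : ∀ i j k, X i j k = X j i k) (hs' : ∀ i j k, X i j k = X i k j)
    (ht : ∀ k, ∑ a, ∑ b, gInv g y a b * X a b k = 0) :
    ∃ s : Pair, ∀ i j k, X i j k = Sf p q s (E i) (E j) (E k) := by
  obtain ⟨s, t, hX⟩ := h.exists_eq_Tf hs ht
  have h0 : ∀ i, tf t (E i) = 0 := by
    intro i
    have h1 := h.trace_Tf s t i
    simp only [← hX, hs' _ i _, ht] at h1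
    linarith
  obtain ⟨h1, h2⟩ := h.ext (A := t.1) (B := t.2) fun i => by
    rw [← h0 i]; simp only [tf]; ring
  refine ⟨s, fun i j k => ?_⟩
  rw [hX]
  simp only [Tf, tracePart, tf, h1, h2]
  ring

theorem IsFrame.trace_Sf (h : IsFrame g y p q E) (s : Pair) (k : Fin 2) :
    ∑ a, ∑ b, gInv g y a b * Sf p q s (E a) (E b) (E k) = 0 := by
  rw [h.contract (Φ := fun a b => Sf p q s a b (E k))
    (by intro a b; simp only [Sf]; ring)]
  simp only [Sf]
  rcases h.hp with rfl | rfl <;> rcases h.hq with rfl | rfl <;> ring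

theorem IsFrame.tForm_eq (h : IsFrame g y p q E) {T : Comp 3} {s t : Pair}
    (hT : ∀ i j k, T y ![i, j, k] = Tf p q s t (E i) (E j) (E k)) (i : Fin 2) :
    tForm g T y ![i] = tf t (E i) := by
  show 1 / 2 * ∑ a, ∑ b, gInv g y a b * T y ![a, i, b] = _
  simp only [hT, h.trace_Tf]
  ring

theorem IsFrame.Spart_eq_Sf (h : IsFrame g y p q E) {T : Comp 3} {s t : Pair}
    (hT : ∀ i j k, T y ![i, j, k] = Tf p q s t (E i) (E j) (E k)) (i j k : Fin 2) :
    Spart g T y ![i, j, k] = Sf p q s (E i) (E j) (E k) := by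
  rw [Spart_eq, hT]
  simp only [h.tForm_eq hT, Tf, h.met, tracePart, Gf]
  ring

end frame

/-- In dimension two, subtracting the trace terms from a tensor that is symmetric and trace-free in
its first two slots leaves a totally symmetric tensor. -/
theorem Spart_symm_trace {g : Comp 2} {T : Comp 3} {y : Plane}
    (hs : ∀ i j, g y ![i, j] = g y ![j, i])
    (hd : g y ![0, 0] * g y ![1, 1] - g y ![0, 1] * g y ![1, 0] ≠ 0)
    (hT : ∀ i j k, T y ![i, j, k] = T y ![j, i, k])
    (htr : ∀ k, ∑ a, ∑ b, gInv g y a b * T y ![a, b, k] = 0) :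
    (∀ i j k, Spart g T y ![i, j, k] = Spart g T y ![j, i, k]) ∧
    (∀ i j k, Spart g T y ![i, j, k] = Spart g T y ![i, k, j]) ∧
    (∀ k, ∑ a, ∑ b, gInv g y a b * Spart g T y ![a, b, k] = 0) := by
  obtain ⟨p, q, E, h⟩ := exists_isFrame g y (hs 0 1) hd
  obtain ⟨s, t, hX⟩ := h.exists_eq_Tf (X := fun i j k => T y ![i, j, k]) hT htr
  refine ⟨fun i j k => ?_, fun i j k => ?_, fun k => ?_⟩
  · rw [h.Spart_eq_Sf hX, h.Spart_eq_Sf hX]; simp only [Sf]; ring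
  · rw [h.Spart_eq_Sf hX, h.Spart_eq_Sf hX]; simp only [Sf]; ring
  · simp only [h.Spart_eq_Sf hX, h.trace_Sf]

/-- The components near `y` of a metric and of the structure tensors, with their smoothness,
symmetries and vanishing traces. -/
structure TensorsAt (g : Comp 2) (T : Comp 3) (τ : Comp 2) (y : Plane) : Prop where
  metric : MetricAt g y
  smooth_T : SmoothAt T y
  smooth_τ : SmoothAt τ y
  symm_T : ∀ᶠ z in 𝓝 y, ∀ i j k, T z ![i, j, k] = T z ![j, i, k]
  trace_T : ∀ᶠ z in 𝓝 y, ∀ k, ∑ a, ∑ b, gInv g z a b * T z ![a, b, k] = 0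
  symm_τ : ∀ᶠ z in 𝓝 y, ∀ i j, τ z ![i, j] = τ z ![j, i]
  trace_τ : ∀ᶠ z in 𝓝 y, ∑ a, ∑ b, gInv g z a b * τ z ![a, b] = 0

section build

variable {g : Comp 2} {T : Comp 3} {τ : Comp 2} {y : Plane}

theorem cov_two_symm {A : Comp 2} (hA : ∀ᶠ z in 𝓝 y, ∀ i j, A z ![i, j] = A z ![j, i])
    (i j l : Fin 2) : cov g A y ![i, j, l] = cov g A y ![j, i, l] := by
  have h0 := hA.self_of_nhds
  rw [cov_two, cov_two, pd_congr l (by filter_upwards [hA] with z hz using hz i j)]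
  congr 1
  refine Finset.sum_congr rfl fun m _ => ?_
  rw [h0 m j, h0 i m]; ring

theorem cov_three_symm {A : Comp 3}
    (hA : ∀ᶠ z in 𝓝 y, ∀ i j k, A z ![i, j, k] = A z ![j, i, k])
    (i j k l : Fin 2) : cov g A y ![i, j, k, l] = cov g A y ![j, i, k, l] := by
  have h0 := hA.self_of_nhds
  rw [cov_three, cov_three, pd_congr l (by filter_upwards [hA] with z hz using hz i j k)]
  congr 1
  refine Finset.sum_congr rfl fun m _ => ?_
  rw [h0 m j, h0 i m, h0 i j]; ring

theorem cov_three_symm' {A : Comp 3}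
    (hA : ∀ᶠ z in 𝓝 y, ∀ i j k, A z ![i, j, k] = A z ![i, k, j])
    (i j k l : Fin 2) : cov g A y ![i, j, k, l] = cov g A y ![i, k, j, l] := by
  have h0 := hA.self_of_nhds
  rw [cov_three, cov_three, pd_congr l (by filter_upwards [hA] with z hz using hz i j k)]
  congr 1
  refine Finset.sum_congr rfl fun m _ => ?_
  rw [h0 m j, h0 i m, h0 i j]; ring

/-- Structure tensors are described by frame data at each point: the symmetries and trace
conditions, which hold near `y`, pass to the covariant derivatives. -/
theorem TensorsAt.exists_frameData (H : TensorsAt g T τ y) :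
    ∃ p q E s t u ds dt du κ, FrameData g T (Spart g T) τ y p q E s t u ds dt du κ := by
  have hg := H.metric
  have hdet := hg.det.self_of_nhds
  have ht := smoothAt_tForm hg H.smooth_T
  have hS := smoothAt_Spart hg H.smooth_T
  have hSp := (hg.symm.and (hg.det.and (H.symm_T.and H.trace_T))).mono fun z hz =>
    Spart_symm_trace hz.1 hz.2.1 hz.2.2.1 hz.2.2.2
  obtain ⟨p, q, E, h⟩ := exists_isFrame g y (hg.symm.self_of_nhds 0 1) hdet
  obtain ⟨s, t, hT⟩ := h.exists_eq_Tf (X := fun i j k => T y ![i, j, k]) H.symm_T.self_of_nhds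
    H.trace_T.self_of_nhds
  obtain ⟨u, hu⟩ := h.exists_eq_Cf (c := fun i j => τ y ![i, j]) H.symm_τ.self_of_nhds
    H.trace_τ.self_of_nhds
  choose dsl hds using fun l => h.exists_eq_Sf (X := fun i j k => cov g (Spart g T) y ![i, j, k, l])
    (fun i j k => cov_three_symm (hSp.mono fun z hz => hz.1) i j k l)
    (fun i j k => cov_three_symm' (hSp.mono fun z hz => hz.2.1) i j k l)
    (fun k => trace_cov_three hg hS (hSp.mono fun z hz => hz.2.2) k l)
  choose dul hdu using fun l => h.exists_eq_Cf (c := fun i j => cov g τ y ![i, j, l])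
    (fun i j => cov_two_symm H.symm_τ i j l) (trace_cov_two hg H.smooth_τ H.trace_τ l)
  choose dt0 dt1 hdt using fun l => h.exists_comp fun i => cov g (tForm g T) y ![i, l]
  -- a family of pairs indexed by the coordinates, expanded in the frame
  have expand : ∀ c : Fin 2 → Pair, ∃ d : Pair × Pair, ∀ l, c l = lin2 d (E l) := by
    intro c
    obtain ⟨a, b, h1⟩ := h.exists_comp fun l => (c l).1
    obtain ⟨a', b', h2⟩ := h.exists_comp fun l => (c l).2
    refine ⟨((a, b), (a', b')), fun l => Prod.ext ?_ ?_⟩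
    · rw [h1]; simp only [lin2, tf]; ring
    · rw [h2]; simp only [lin2, tf]; ring
  obtain ⟨ds, hds'⟩ := expand dsl
  obtain ⟨du, hdu'⟩ := expand dul
  obtain ⟨dt, hdt'⟩ := expand fun l => (dt0 l, dt1 l)
  have eS : ∀ i j k l, cov g (Spart g T) y ![i, j, k, l]
      = Sf p q (lin2 ds (E l)) (E i) (E j) (E k) := by
    intro i j k l; rw [← hds']; exact hds l i j k
  have et : ∀ i l, cov g (tForm g T) y ![i, l] = tf (lin2 dt (E l)) (E i) := by
    intro i l; rw [← hdt', hdt]; simp only [tf]; ring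
  have eT : ∀ i j k l, cov g T y ![i, j, k, l]
      = Tf p q (lin2 ds (E l)) (lin2 dt (E l)) (E i) (E j) (E k) := by
    intro i j k l
    have := cov_Spart hg H.smooth_T ht i j k l
    rw [eS, eq_sub_iff_add_eq] at this
    rw [← this]
    simp only [et, h.met]
    rfl
  refine ⟨p, q, E, s, t, u, ds, dt, du, scal g y / 2, ⟨h, hT, h.Spart_eq_Sf hT, h.tForm_eq hT, hu,
    eS, eT, et, ?_, ?_, ?_, riem_eq_scal hg, by ring⟩⟩
  · intro i j l; rw [← hdu']; exact hdu l i j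
  · intro i j k m n l
    rw [cov_Pten hg H.smooth_T ht]
    simp only [h.met, eT, et]
    rfl
  · intro i j k l
    rw [cov_Lam hg H.smooth_T ht]
    simp only [h.met, eT, et]
    rfl

/-- The integrability conditions at a point. The first condition on the right-hand side says that
the trace of `T` is a closed 1-form. -/
theorem TensorsAt.integrability_iff (H : TensorsAt g T τ y) :
    ((∀ i j, τ y ![i, j] = rawTau g T y i j) ∧ RicciV g T τ y ∧ RicciC g T y) ↔
    (∀ k l, cov g (tForm g T) y ![k, l] = cov g (tForm g T) y ![l, k]) ∧
      CondLap g (Spart g T) (tForm g T) y ∧ CondDS g (Spart g T) (tForm g T) y ∧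
      CondTau g (Spart g T) (tForm g T) τ y ∧
      CondQ g T τ (tForm g T) y ∧ CondGamma g T τ (tForm g T) y := by
  obtain ⟨p, q, E, s, t, u, ds, dt, du, κ, h⟩ := H.exists_frameData
  exact h.integrability_iff

theorem condT_Spart (hd : g y ![0, 0] * g y ![1, 1] - g y ![0, 1] * g y ![1, 0] ≠ 0) :
    CondT g T (Spart g T) (tForm g T) y := by
  intro i j k
  have : ∑ a, ∑ b, gInv g y a b * (tForm g T y ![a] * g y ![b, k]) = tForm g T y ![k] := by
    have e : ∀ a, ∑ b, gInv g y a b * (tForm g T y ![a] * g y ![b, k])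
        = tForm g T y ![a] * ∑ b, gInv g y a b * g y ![b, k] := by
      intro a; rw [Finset.mul_sum]; refine Finset.sum_congr rfl fun b _ => ?_; ring
    simp only [e, gInv_mul hd]
    simp
  rw [Spart_eq, symTF2, this, tracePart]
  ring

/-- The 1-form and the totally symmetric tensor in the decomposition of `T` are determined
by `T`. -/
theorem condT_unique (hs : ∀ i j, g y ![i, j] = g y ![j, i])
    (hd : g y ![0, 0] * g y ![1, 1] - g y ![0, 1] * g y ![1, 0] ≠ 0) {S : Comp 3} {θ : Comp 1}
    (hS : ∀ i j k, S y ![i, j, k] = S y ![i, k, j])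
    (htr : ∀ k, ∑ a, ∑ b, gInv g y a b * S y ![a, b, k] = 0) (h : CondT g T S θ y) :
    (∀ i, tForm g T y ![i] = θ y ![i]) ∧ ∀ i j k, Spart g T y ![i, j, k] = S y ![i, j, k] := by
  obtain ⟨p, q, E, hE⟩ := exists_isFrame g y (hs 0 1) hd
  obtain ⟨A, B, hθ⟩ := hE.exists_comp fun i => θ y ![i]
  have hθ' : ∀ i, θ y ![i] = tf (A, B) (E i) := by
    intro i; rw [hθ]; simp only [tf]; ring
  have htr' : ∀ k, ∑ a, ∑ b, gInv g y a b * (θ y ![a] * g y ![b, k]) = θ y ![k] := by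
    intro k
    have e : ∀ a, ∑ b, gInv g y a b * (θ y ![a] * g y ![b, k])
        = θ y ![a] * ∑ b, gInv g y a b * g y ![b, k] := by
      intro a; rw [Finset.mul_sum]; refine Finset.sum_congr rfl fun b _ => ?_; ring
    simp only [e, gInv_mul hd]
    simp
  have h1 : ∀ i j k, T y ![i, j, k] = S y ![i, j, k] + Tf p q 0 (A, B) (E i) (E j) (E k) := by
    intro i j k
    rw [h i j k, symTF2, htr']
    simp only [hθ', Tf, Sf, tracePart, hE.met, Gf, Prod.fst_zero, Prod.snd_zero]
    ring
  have h2 : ∀ i, tForm g T y ![i] = θ y ![i] := by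
    intro i
    show 1 / 2 * ∑ a, ∑ b, gInv g y a b * T y ![a, i, b] = _
    simp only [h1, mul_add, Finset.sum_add_distrib, hE.trace_Tf, hS _ i _, htr, hθ']
    ring
  refine ⟨h2, fun i j k => ?_⟩
  rw [Spart_eq, h1]
  simp only [h2, hθ', Tf, Sf, tracePart, hE.met, Gf, Prod.fst_zero, Prod.snd_zero]
  ring

end build

/-! ### Coordinate bases of the tangent spaces -/

section algebra

variable {V : Type*} [AddCommGroup V] [Module ℝ V]

theorem multilinear_two_sum (G : MultilinearMap ℝ (fun _ : Fin 2 => V) ℝ) (b : Fin 2 → V)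
    (J : Matrix (Fin 2) (Fin 2) ℝ) (i j : Fin 2) :
    G ![∑ c, J c i • b c, ∑ d, J d j • b d] = ∑ c, ∑ d, J c i * J d j * G ![b c, b d] := by
  have h1 : ∀ x y z : V, ∀ r s : ℝ, G ![r • x + s • y, z] = r * G ![x, z] + s * G ![y, z] := by
    intro x y z r s
    have e : ∀ w : V, ![w, z] = Function.update ![x, z] 0 w := by
      intro w; ext k; fin_cases k <;> rfl
    rw [e, e y, G.map_update_add, G.map_update_smul, G.map_update_smul, ← e, ← e]
    rfl
  have h2 : ∀ x y z : V, ∀ r s : ℝ, G ![z, r • x + s • y] = r * G ![z, x] + s * G ![z, y] := by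
    intro x y z r s
    have e : ∀ w : V, ![z, w] = Function.update ![z, x] 1 w := by
      intro w; ext k; fin_cases k <;> rfl
    rw [e, e y, G.map_update_add, G.map_update_smul, G.map_update_smul, ← e, ← e]
    rfl
  simp only [Fin.sum_univ_two, h1, h2]
  ring

/-- Contraction of two slots of a tensor with the inverse of a Gram matrix does not depend on the
basis. -/
theorem contraction_basis_indep (G B : MultilinearMap ℝ (fun _ : Fin 2 => V) ℝ)
    (b b' : Module.Basis (Fin 2) ℝ V)
    (hG : (Matrix.of fun i j => G ![b' i, b' j]).det ≠ 0) :
    ∑ i, ∑ j, (Matrix.of fun i j => G ![b i, b j])⁻¹ i j * B ![b i, b j]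
      = ∑ i, ∑ j, (Matrix.of fun i j => G ![b' i, b' j])⁻¹ i j * B ![b' i, b' j] := by
  set J : Matrix (Fin 2) (Fin 2) ℝ := b.toMatrix b' with hJ
  have hb : ∀ i, b' i = ∑ c, J c i • b c := fun i => (b.sum_toMatrix_smul_self b' i).symm
  have expand : ∀ F : MultilinearMap ℝ (fun _ : Fin 2 => V) ℝ,
      (Matrix.of fun i j => F ![b' i, b' j])
        = J.transpose * (Matrix.of fun i j => F ![b i, b j]) * J := by
    intro F
    ext i j
    rw [Matrix.of_apply, hb i, hb j, multilinear_two_sum]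
    simp only [Matrix.of_apply, Matrix.mul_apply, Matrix.transpose_apply, Fin.sum_univ_two]
    ring
  have tr : ∀ X Y : Matrix (Fin 2) (Fin 2) ℝ, ∑ i, ∑ j, X i j * Y i j
      = (X * Y.transpose).trace := by
    intro X Y
    simp [Matrix.trace, Matrix.mul_apply]
  have hJu : IsUnit J.det := by
    rw [expand G, Matrix.det_mul, Matrix.det_mul] at hG
    exact isUnit_iff_ne_zero.2 (right_ne_zero_of_mul hG)
  have hJt : IsUnit J.transpose.det := by rwa [Matrix.det_transpose]
  have e1 := tr (Matrix.of fun i j => G ![b i, b j])⁻¹ (Matrix.of fun i j => B ![b i, b j])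
  have e2 := tr (Matrix.of fun i j => G ![b' i, b' j])⁻¹ (Matrix.of fun i j => B ![b' i, b' j])
  simp only [Matrix.of_apply] at e1 e2
  rw [e1, e2, expand G, expand B]
  generalize (Matrix.of fun i j => G ![b i, b j]) = X
  generalize (Matrix.of fun i j => B ![b i, b j]) = Y
  rw [Matrix.mul_inv_rev, Matrix.mul_inv_rev, Matrix.transpose_mul, Matrix.transpose_mul,
    Matrix.transpose_transpose]
  have : J⁻¹ * (X⁻¹ * J.transpose⁻¹) * (J.transpose * (Y.transpose * J))
      = J⁻¹ * (X⁻¹ * ((J.transpose⁻¹ * J.transpose) * Y.transpose) * J) := by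
    simp only [Matrix.mul_assoc]
  rw [this, Matrix.nonsing_inv_mul _ hJt, Matrix.one_mul, Matrix.trace_mul_comm J⁻¹,
    Matrix.mul_assoc _ J,
    Matrix.mul_nonsing_inv _ hJu, Matrix.mul_one]

end algebra

section tangent

variable {M : Type*} [TopologicalSpace M] [ChartedSpace Plane M]
  {e : OpenPartialHomeomorph M Plane} {y : Plane}

theorem mdifferentiable_of_mem_charts (he : e ∈ charts M) :
    e.MDifferentiable 𝓘(ℝ, Plane) 𝓘(ℝ, Plane) :=
  ⟨(contMDiffOn_of_mem_maximalAtlas he).mdifferentiableOn (by simp),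
    (contMDiffOn_symm_of_mem_maximalAtlas he).mdifferentiableOn (by simp)⟩

/-- The coordinate vectors of a chart form a basis of the tangent space. -/
def coordBasis (he : e ∈ charts M) (hy : y ∈ e.target) :
    Module.Basis (Fin 2) ℝ (TangentSpace 𝓘(ℝ, Plane) (e.symm y)) :=
  (EuclideanSpace.basisFun (Fin 2) ℝ).toBasis.map
    ((mdifferentiable_of_mem_charts he).symm.mfderiv hy).toLinearEquiv

theorem coordBasis_apply (he : e ∈ charts M) (hy : y ∈ e.target) (i : Fin 2) :
    coordBasis he hy i = coordVec e y i := by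
  have h1 : (EuclideanSpace.basisFun (Fin 2) ℝ).toBasis i = EuclideanSpace.single i (1 : ℝ) := by
    simp
  have h2 : coordBasis he hy i = mfderiv 𝓘(ℝ, Plane) 𝓘(ℝ, Plane) e.symm y
      ((EuclideanSpace.basisFun (Fin 2) ℝ).toBasis i : Plane) := rfl
  rw [h2, h1]
  rfl

theorem TensorField.comp_two (A : TensorField M 2) (i j : Fin 2) :
    A.comp e y ![i, j] = A.form (e.symm y) ![coordVec e y i, coordVec e y j] := by
  have : (fun a => coordVec e y ((![i, j] : Fin 2 → Fin 2) a))
      = ![coordVec e y i, coordVec e y j] := by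
    ext1 a; fin_cases a <;> rfl
  simp only [TensorField.comp]
  rw [this]

theorem TensorField.comp_three (A : TensorField M 3) (i j k : Fin 2) :
    A.comp e y ![i, j, k]
      = A.form (e.symm y) ![coordVec e y i, coordVec e y j, coordVec e y k] := by
  have : (fun a => coordVec e y ((![i, j, k] : Fin 3 → Fin 2) a))
      = ![coordVec e y i, coordVec e y j, coordVec e y k] := by
    ext1 a; fin_cases a <;> rfl
  simp only [TensorField.comp]
  rw [this]

theorem TensorField.smoothAt {k : ℕ} (A : TensorField M k) (he : e ∈ charts M)
    (hy : y ∈ e.target) : SmoothAt (A.comp e) y := fun I =>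
  (A.smooth e he I).contDiffAt (e.open_target.mem_nhds hy)

theorem TensorField.IsMetric.det_ne_zero {g : TensorField M 2} (hg : g.IsMetric)
    (he : e ∈ charts M) (hy : y ∈ e.target) :
    g.comp e y ![0, 0] * g.comp e y ![1, 1] - g.comp e y ![0, 1] * g.comp e y ![1, 0] ≠ 0 := by
  intro hdet
  -- a vector in the kernel of the Gram matrix pairs to zero with all tangent vectors
  have ker : ∀ c : Fin 2 → ℝ, (∀ j, ∑ i, c i * g.comp e y ![i, j] = 0) → c = 0 := by
    intro c hc
    have h0 : ∑ i, c i • coordVec e y i = 0 := by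
      refine hg.2 (e.symm y) _ fun v => ?_
      have hv : v = ∑ j, (coordBasis he hy).repr v j • coordVec e y j := by
        simp only [← coordBasis_apply he hy]
        exact ((coordBasis he hy).sum_repr v).symm
      rw [hv]
      have := multilinear_two_sum (g.form (e.symm y)) (coordVec e y)
        (Matrix.of fun i a => if a = 0 then c i else (coordBasis he hy).repr v i) 0 1
      simp only [Matrix.of_apply, if_true, one_ne_zero, if_false, ← TensorField.comp_two] at this
      rw [this]
      have h0 := hc 0
      have h1 := hc 1
      simp only [Fin.sum_univ_two] at h0 h1 ⊢
      linear_combination ((coordBasis he hy).repr v 0) * h0 + ((coordBasis he hy).repr v 1) * h1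
    simp only [← coordBasis_apply he hy] at h0
    exact funext (Fintype.linearIndependent_iff.1 (coordBasis he hy).linearIndependent c h0)
  have k1 := ker ![g.comp e y ![1, 1], -g.comp e y ![0, 1]] (by
    intro j; fin_cases j <;> simp [Fin.sum_univ_two]
    · linear_combination hdet
    · ring)
  have k2 := ker ![-g.comp e y ![1, 0], g.comp e y ![0, 0]] (by
    intro j; fin_cases j <;> simp [Fin.sum_univ_two]
    · ring
    · linear_combination hdet)
  have k3 := ker ![1, 0] (by
    have a1 := congrFun k2 1
    have a2 := congrFun k1 1
    simp at a1 a2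
    intro j; fin_cases j <;> simp [Fin.sum_univ_two, a1, a2])
  simpa using congrFun k3 0

theorem TensorField.IsMetric.metricAt {g : TensorField M 2} (hg : g.IsMetric)
    (he : e ∈ charts M) (hy : y ∈ e.target) : MetricAt (g.comp e) y := by
  refine ⟨g.smoothAt he hy, ?_, ?_⟩
  · filter_upwards with z i j
    rw [g.comp_two, g.comp_two, hg.1]
  · filter_upwards [e.open_target.mem_nhds hy] with z hz using hg.det_ne_zero he hz

end tangent

/-! ### The trace form and the totally symmetric part of `T` as tensor fields -/

section global

variable {M : Type*} [TopologicalSpace M] [ChartedSpace Plane M]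
  {e : OpenPartialHomeomorph M Plane} {y : Plane}

/-- The bilinear form `(a, b) ↦ T(a, u, b)`. -/
def midForm (T : TensorField M 3) (x : M) (u : TangentSpace 𝓘(ℝ, Plane) x) :
    MultilinearMap ℝ (fun _ : Fin 2 => TangentSpace 𝓘(ℝ, Plane) x) ℝ :=
  ((((T.form x).domDomCongr (Equiv.swap 0 1)).curryLeft) u)

theorem midForm_apply (T : TensorField M 3) (x : M) (u a b : TangentSpace 𝓘(ℝ, Plane) x) :
    midForm T x u ![a, b] = T.form x ![a, u, b] := by
  simp only [midForm, MultilinearMap.curryLeft_apply, MultilinearMap.domDomCongr_apply]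
  congr 1
  ext1 i; fin_cases i <;> rfl

/-- A basis of the tangent space; the trace form below is defined with it and does not depend
on it. -/
def refBasis (x : M) : Module.Basis (Fin 2) ℝ (TangentSpace 𝓘(ℝ, Plane) x) :=
  (EuclideanSpace.basisFun (Fin 2) ℝ).toBasis

/-- The 1-form `u ↦ ½ g^{ab} T(∂_a, u, ∂_b)`. -/
def traceForm (g : TensorField M 2) (T : TensorField M 3) (x : M) :
    TangentSpace 𝓘(ℝ, Plane) x →ₗ[ℝ] ℝ where
  toFun u := 1 / 2 * ∑ a, ∑ b,
    (Matrix.of fun i j => g.form x ![refBasis x i, refBasis x j])⁻¹ a b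
      * midForm T x u ![refBasis x a, refBasis x b]
  map_add' u v := by
    simp only [midForm, map_add, add_apply, mul_add, Finset.sum_add_distrib]
  map_smul' r u := by
    simp only [midForm, map_smul, smul_apply, smul_eq_mul, RingHom.id_apply,
      Finset.mul_sum]
    refine Finset.sum_congr rfl fun a _ => Finset.sum_congr rfl fun b _ => ?_
    ring

/-- The trace form does not depend on the basis used to define it: in every chart its components are
`t_i`. -/
theorem traceForm_coordVec {g : TensorField M 2} (hg : g.IsMetric) (T : TensorField M 3)
    (he : e ∈ charts M) (hy : y ∈ e.target) (i : Fin 2) :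
    traceForm g T (e.symm y) (coordVec e y i) = tForm (g.comp e) (T.comp e) y ![i] := by
  have hdet := hg.det_ne_zero he hy
  have h := contraction_basis_indep (g.form (e.symm y)) (midForm T (e.symm y) (coordVec e y i))
    (refBasis (e.symm y)) (coordBasis he hy) (by
      rw [Matrix.det_fin_two]
      simp only [coordBasis_apply, Matrix.of_apply, ← TensorField.comp_two]
      exact hdet)
  show 1 / 2 * ∑ a, ∑ b, _ = 1 / 2 * ∑ a, ∑ b, gInv (g.comp e) y a b * T.comp e y ![a, i, b]
  rw [h]
  simp only [coordBasis_apply, midForm_apply, ← TensorField.comp_two, ← TensorField.comp_three]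
  rfl

/-- The tensor `θ(u) g(v, w)`. -/
def traceTensor (g : TensorField M 2) (T : TensorField M 3) (x : M) :
    MultilinearMap ℝ (fun _ : Fin 3 => TangentSpace 𝓘(ℝ, Plane) x) ℝ :=
  ((traceForm g T x).smulRight (g.form x)).uncurryLeft

theorem traceTensor_apply (g : TensorField M 2) (T : TensorField M 3) (x : M)
    (v : Fin 3 → TangentSpace 𝓘(ℝ, Plane) x) :
    traceTensor g T x v = traceForm g T x (v 0) * g.form x ![v 1, v 2] := by
  simp only [traceTensor, LinearMap.uncurryLeft_apply, LinearMap.smulRight_apply,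
    smul_apply, smul_eq_mul]
  congr 2
  ext1 i; fin_cases i <;> rfl

/-- `T` minus its trace terms, as a multilinear form on a tangent space. -/
def symForm (g : TensorField M 2) (T : TensorField M 3) (x : M) :
    MultilinearMap ℝ (fun _ : Fin 3 => TangentSpace 𝓘(ℝ, Plane) x) ℝ :=
  T.form x - (traceTensor g T x + (traceTensor g T x).domDomCongr (Equiv.swap 0 1)
    - (traceTensor g T x).domDomCongr (Equiv.swap 0 2))

theorem symForm_coordVec {g : TensorField M 2} (hg : g.IsMetric) (T : TensorField M 3)
    (he : e ∈ charts M) (hy : y ∈ e.target) (I : Fin 3 → Fin 2) :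
    symForm g T (e.symm y) (fun a => coordVec e y (I a)) = Spart (g.comp e) (T.comp e) y I := by
  have s1 : (Equiv.swap 0 1 : Equiv.Perm (Fin 3)) 2 = 2 := by decide
  have s2 : (Equiv.swap 0 2 : Equiv.Perm (Fin 3)) 1 = 1 := by decide
  have hsy := hg.1 (e.symm y)
  simp only [symForm, sub_apply, add_apply,
    MultilinearMap.domDomCongr_apply, traceTensor_apply, Equiv.swap_apply_left,
    Equiv.swap_apply_right, s1, s2, traceForm_coordVec hg T he hy, ← TensorField.comp_two]
  have h21 : g.comp e y ![I 1, I 0] = g.comp e y ![I 0, I 1] := by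
    rw [g.comp_two, g.comp_two, hsy]
  have hT : T.form (e.symm y) (fun a => coordVec e y (I a)) = T.comp e y I := rfl
  simp only [Spart, tracePart, h21, hT]
  ring

/-- The totally symmetric trace-free part of `T` as a tensor field. -/
def symField (g : TensorField M 2) (hg : g.IsMetric) (T : TensorField M 3) : TensorField M 3 where
  form := symForm g T
  smooth e he I := by
    have : ∀ y ∈ e.target, symForm g T (e.symm y) (fun a => coordVec e y (I a))
        = Spart (g.comp e) (T.comp e) y I := fun y hy => symForm_coordVec hg T he hy I
    refine ContDiffOn.congr (fun y hy => ContDiffAt.contDiffWithinAt ?_) this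
    exact smoothAt_Spart (hg.metricAt he hy) (T.smoothAt he hy) I

theorem symField_comp {g : TensorField M 2} (hg : g.IsMetric) (T : TensorField M 3)
    (he : e ∈ charts M) (hy : y ∈ e.target) :
    (symField g hg T).comp e y = Spart (g.comp e) (T.comp e) y :=
  funext fun I => symForm_coordVec hg T he hy I

/-- Symmetry under the two adjacent transpositions is total symmetry. -/
theorem symm_of_adjacent {X : (Fin 3 → Fin 2) → ℝ} (h1 : ∀ i j k, X ![i, j, k] = X ![j, i, k])
    (h2 : ∀ i j k, X ![i, j, k] = X ![i, k, j]) (I : Fin 3 → Fin 2) (σ : Equiv.Perm (Fin 3)) :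
    X (fun a => I (σ a)) = X I := by
  have e1 : (fun a => I (σ a)) = ![I (σ 0), I (σ 1), I (σ 2)] := by
    ext1 a; fin_cases a <;> rfl
  have e2 : I = ![I 0, I 1, I 2] := by
    ext1 a; fin_cases a <;> rfl
  have key : ∀ σ : Equiv.Perm (Fin 3), (σ 0, σ 1, σ 2) ∈ ([(0, 1, 2), (0, 2, 1), (1, 0, 2),
      (1, 2, 0), (2, 0, 1), (2, 1, 0)] : List (Fin 3 × Fin 3 × Fin 3)) := by decide
  have hσ := key σ
  rw [e1]
  conv_rhs => rw [e2]
  simp only [List.mem_cons, Prod.mk.injEq, List.not_mem_nil, or_false] at hσ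
  rcases hσ with ⟨a, b, c⟩ | ⟨a, b, c⟩ | ⟨a, b, c⟩ | ⟨a, b, c⟩ | ⟨a, b, c⟩ | ⟨a, b, c⟩ <;>
    rw [a, b, c]
  · exact h2 _ _ _
  · exact h1 _ _ _
  · exact (h2 _ _ _).trans (h1 _ _ _)
  · exact (h1 _ _ _).trans (h2 _ _ _)
  · exact (h1 _ _ _).trans ((h2 _ _ _).trans (h1 _ _ _))

/-- A tensor with totally symmetric components is totally symmetric. -/
theorem form_symm {A : TensorField M 3} (he : e ∈ charts M) (hy : y ∈ e.target)
    (h : ∀ (I : Fin 3 → Fin 2) (σ : Equiv.Perm (Fin 3)),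
      A.comp e y (fun a => I (σ a)) = A.comp e y I)
    (v : Fin 3 → TangentSpace 𝓘(ℝ, Plane) (e.symm y)) (σ : Equiv.Perm (Fin 3)) :
    A.form (e.symm y) (fun a => v (σ a)) = A.form (e.symm y) v := by
  have : (A.form (e.symm y)).domDomCongr σ = A.form (e.symm y) := by
    refine Module.Basis.ext_multilinear (fun _ => coordBasis he hy) fun I => ?_
    simp only [MultilinearMap.domDomCongr_apply, coordBasis_apply]
    exact h I σ
  exact DFunLike.congr_fun this v

end global

/-! ### Closed 1-forms and potentials -/

section closed

variable {g : Comp 2} {y : Plane}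

/-- Closedness of a 1-form, in terms of partial or of covariant derivatives. -/
theorem cov_symm_iff_pd_symm (hs : ∀ᶠ z in 𝓝 y, ∀ i j, g z ![i, j] = g z ![j, i]) (θ : Comp 1)
    (k l : Fin 2) : cov g θ y ![k, l] = cov g θ y ![l, k] ↔
      pd l (fun z => θ z ![k]) y = pd k (fun z => θ z ![l]) y := by
  rw [cov_one, cov_one]
  simp only [chris_symm hs _ k l, sub_left_inj]

theorem cov_diffl_symm (hs : ∀ᶠ z in 𝓝 y, ∀ i j, g z ![i, j] = g z ![j, i]) {f : Plane → ℝ}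
    (hf : ContDiffAt ℝ ∞ f y) (k l : Fin 2) :
    cov g (diffl f) y ![k, l] = cov g (diffl f) y ![l, k] :=
  (cov_symm_iff_pd_symm hs _ k l).2 (pd_comm l k hf)

theorem fderiv_eq_pd (f : Plane → ℝ) (y v : Plane) :
    fderiv ℝ f y v = v 0 * pd 0 f y + v 1 * pd 1 f y := by
  have hv : v = v 0 • EuclideanSpace.single 0 (1 : ℝ) + v 1 • EuclideanSpace.single 1 (1 : ℝ) := by
    ext i; fin_cases i <;> simp
  conv_lhs => rw [hv]
  rw [map_add, map_smul, map_smul]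
  rfl

/-- The Poincaré lemma on a convex open set. -/
theorem exists_diffl_eq {s : Set Plane} (hs : Convex ℝ s) (hso : IsOpen s) {θ : Comp 1}
    (hθ : ∀ z ∈ s, SmoothAt θ z)
    (hc : ∀ z ∈ s, ∀ k l, pd l (fun z => θ z ![k]) z = pd k (fun z => θ z ![l]) z) :
    ∃ f : Plane → ℝ, ContDiffOn ℝ ∞ f s ∧ ∀ z ∈ s, diffl f z = θ z := by
  let η : Plane → Plane →L[ℝ] ℝ := fun z =>
    θ z ![0] • EuclideanSpace.proj (0 : Fin 2) + θ z ![1] • EuclideanSpace.proj (1 : Fin 2)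
  have hη : ContDiffOn ℝ ∞ η s := fun z hz =>
    (((hθ z hz ![0]).smul contDiffAt_const).add
      ((hθ z hz ![1]).smul contDiffAt_const)).contDiffWithinAt
  have hd : ∀ z ∈ s, ∀ u v : Plane, fderiv ℝ η z u v
      = fderiv ℝ (fun z => θ z ![0]) z u * v 0 + fderiv ℝ (fun z => θ z ![1]) z u * v 1 := by
    intro z hz u v
    have h0 := (hθ z hz).diff ![0]
    have h1 := (hθ z hz).diff ![1]
    have := (h0.hasFDerivAt.smul_const (EuclideanSpace.proj (0 : Fin 2) : Plane →L[ℝ] ℝ)).add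
      (h1.hasFDerivAt.smul_const (EuclideanSpace.proj (1 : Fin 2) : Plane →L[ℝ] ℝ))
    have h2 : fderiv ℝ η z = _ := this.fderiv
    rw [h2]
    simp
  obtain ⟨f, hf⟩ := hs.exists_forall_hasFDerivAt_of_fderiv_symmetric hso
    (hη.differentiableOn (by simp)) fun z hz u v => by
      rw [hd z hz, hd z hz]
      simp only [fderiv_eq_pd, hc z hz 0 1]
      ring
  refine ⟨f, (contDiffOn_infty_iff_fderiv_of_isOpen hso).2
    ⟨fun z hz => (hf z hz).differentiableAt.differentiableWithinAt,
      hη.congr fun z hz => (hf z hz).fderiv⟩, fun z hz => ?_⟩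
  funext I
  have hI : I = ![I 0] := by ext a; fin_cases a; rfl
  rw [hI]
  generalize I 0 = i
  show fderiv ℝ f z _ = _
  rw [(hf z hz).fderiv]
  fin_cases i <;> simp [η]

end closed

section congruence

variable {g : Comp 2} {T S S' : Comp 3} {τ : Comp 2} {dt dt' : Comp 1} {y : Plane}

/-- The structural conditions at a point depend only on the germs of the tensors. -/
theorem conditions_congr (hS : ∀ᶠ z in 𝓝 y, S z = S' z) (ht : ∀ᶠ z in 𝓝 y, dt z = dt' z) :
    (CondT g T S dt y ↔ CondT g T S' dt' y) ∧
    ((CondLap g S dt y ∧ CondDS g S dt y ∧ CondTau g S dt τ y ∧ CondQ g T τ dt y ∧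
      CondGamma g T τ dt y) ↔
    (CondLap g S' dt' y ∧ CondDS g S' dt' y ∧ CondTau g S' dt' τ y ∧ CondQ g T τ dt' y ∧
      CondGamma g T τ dt' y)) := by
  simp only [CondT, CondLap, CondDS, CondTau, CondQ, CondGamma, cov_congr g y hS, cov_congr g y ht,
    hS.self_of_nhds, ht.self_of_nhds, and_self]

end congruence

section global

variable {M : Type*} [TopologicalSpace M] [ChartedSpace Plane M]
  {e : OpenPartialHomeomorph M Plane} {y : Plane}

/-- The differential of a function on the surface, evaluated on a coordinate vector. -/
theorem mfderiv_coordVec (he : e ∈ charts M) (hy : y ∈ e.target) {t : M → ℝ}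
    (ht : MDifferentiableAt 𝓘(ℝ, Plane) 𝓘(ℝ, ℝ) t (e.symm y)) (i : Fin 2) :
    mfderiv 𝓘(ℝ, Plane) 𝓘(ℝ, ℝ) t (e.symm y) (coordVec e y i) = pd i (t ∘ e.symm) y := by
  have h := mfderiv_comp_apply y ht ((mdifferentiable_of_mem_charts he).symm.mdifferentiableAt hy)
    (EuclideanSpace.single i (1 : ℝ) : Plane)
  rw [mfderiv_eq_fderiv] at h
  exact h.symm

/-- Closed forms are locally exact: if the trace of `T` is closed, it is the differential of a
function near each point, in every chart. -/
theorem exists_potential [IsManifold 𝓘(ℝ, Plane) ∞ M] {g : TensorField M 2} (hg : g.IsMetric)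
    (T : TensorField M 3)
    (hc : ∀ e ∈ charts M, ∀ y ∈ e.target, ∀ k l, cov (g.comp e) (tForm (g.comp e) (T.comp e)) y
      ![k, l] = cov (g.comp e) (tForm (g.comp e) (T.comp e)) y ![l, k]) (x : M) :
    ∃ U : Set M, IsOpen U ∧ x ∈ U ∧ ∃ t : M → ℝ, ContMDiffOn 𝓘(ℝ, Plane) 𝓘(ℝ, ℝ) ∞ t U ∧
      ∀ e ∈ charts M, ∀ y ∈ e.target, e.symm y ∈ U →
        diffl (t ∘ e.symm) y = tForm (g.comp e) (T.comp e) y := by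
  set e₀ := chartAt Plane x
  have he₀ : e₀ ∈ charts M := IsManifold.chart_mem_maximalAtlas x
  have hx : x ∈ e₀.source := mem_chart_source Plane x
  obtain ⟨r, hr, hB⟩ := Metric.isOpen_iff.1 e₀.open_target (e₀ x) (e₀.map_source hx)
  set B := Metric.ball (e₀ x) r
  obtain ⟨f, hf, hfd⟩ := exists_diffl_eq (convex_ball (e₀ x) r) Metric.isOpen_ball
    (θ := tForm (g.comp e₀) (T.comp e₀))
    (fun z hz => smoothAt_tForm (hg.metricAt he₀ (hB hz)) (T.smoothAt he₀ (hB hz)))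
    (fun z hz k l => (cov_symm_iff_pd_symm (hg.metricAt he₀ (hB hz)).symm _ k l).1
      (hc e₀ he₀ z (hB hz) k l))
  have hU : IsOpen (e₀.source ∩ e₀ ⁻¹' B) := e₀.isOpen_inter_preimage Metric.isOpen_ball
  have ht : ContMDiffOn 𝓘(ℝ, Plane) 𝓘(ℝ, ℝ) ∞ (f ∘ e₀) (e₀.source ∩ e₀ ⁻¹' B) :=
    hf.contMDiffOn.comp ((contMDiffOn_of_mem_maximalAtlas he₀).mono Set.inter_subset_left)
      Set.inter_subset_right
  have hmd : ∀ z ∈ e₀.source ∩ e₀ ⁻¹' B,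
      MDifferentiableAt 𝓘(ℝ, Plane) 𝓘(ℝ, ℝ) (f ∘ e₀) z := fun z hz =>
    (ht.contMDiffAt (hU.mem_nhds hz)).mdifferentiableAt (by simp)
  -- the differential of the potential is the invariantly defined trace form
  have key : ∀ w ∈ B, ∀ u : TangentSpace 𝓘(ℝ, Plane) (e₀.symm w),
      mfderiv 𝓘(ℝ, Plane) 𝓘(ℝ, ℝ) (f ∘ e₀) (e₀.symm w) u = traceForm g T (e₀.symm w) u := by
    intro w hw u
    have hwU : e₀.symm w ∈ e₀.source ∩ e₀ ⁻¹' B :=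
      ⟨e₀.map_target (hB hw), by simpa [e₀.right_inv (hB hw)] using hw⟩
    have hlin : (mfderiv 𝓘(ℝ, Plane) 𝓘(ℝ, ℝ) (f ∘ e₀) (e₀.symm w)).toLinearMap
        = traceForm g T (e₀.symm w) := by
      refine (coordBasis he₀ (hB hw)).ext fun i => ?_
      rw [coordBasis_apply]
      refine Eq.trans ?_ ((congrFun (hfd w hw) ![i]).trans
        (traceForm_coordVec hg T he₀ (hB hw) i).symm)
      refine (mfderiv_coordVec he₀ (hB hw) (hmd _ hwU) i).trans (pd_congr i ?_)
      filter_upwards [e₀.open_target.mem_nhds (hB hw)] with z hz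
      simp [e₀.right_inv hz]
    exact DFunLike.congr_fun hlin u
  refine ⟨e₀.source ∩ e₀ ⁻¹' B, hU, ⟨hx, Metric.mem_ball_self hr⟩, f ∘ e₀, ht,
    fun e he y hy hyU => ?_⟩
  funext I
  have hI : I = ![I 0] := by ext a; fin_cases a; rfl
  rw [hI, ← traceForm_coordVec hg T he hy]
  refine (mfderiv_coordVec he hy (hmd _ hyU) (I 0)).symm.trans ?_
  have := key (e₀ (e.symm y)) hyU.2
  rw [e₀.left_inv hyU.1] at this
  exact this _

theorem tensorsAt {g : TensorField M 2} (hg : g.IsMetric) {T : TensorField M 3}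
    (hTsymm : ∀ x : M, ∀ u v w : TangentSpace 𝓘(ℝ, Plane) x,
      T.form x ![u, v, w] = T.form x ![v, u, w])
    (hTtrace : ∀ e ∈ charts M, ∀ y ∈ e.target, ∀ k : Fin 2,
      ∑ a, ∑ b, gInv (g.comp e) y a b * T.comp e y ![a, b, k] = 0)
    {τ : TensorField M 2}
    (hτsymm : ∀ x : M, ∀ u v : TangentSpace 𝓘(ℝ, Plane) x, τ.form x ![u, v] = τ.form x ![v, u])
    (hτtrace : ∀ e ∈ charts M, ∀ y ∈ e.target,
      ∑ a, ∑ b, gInv (g.comp e) y a b * τ.comp e y ![a, b] = 0)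
    (he : e ∈ charts M) (hy : y ∈ e.target) :
    TensorsAt (g.comp e) (T.comp e) (τ.comp e) y where
  metric := hg.metricAt he hy
  smooth_T := T.smoothAt he hy
  smooth_τ := τ.smoothAt he hy
  symm_T := Eventually.of_forall fun z i j k => by rw [T.comp_three, T.comp_three, hTsymm]
  trace_T := by filter_upwards [e.open_target.mem_nhds hy] with z hz using hTtrace e he z hz
  symm_τ := Eventually.of_forall fun z i j => by rw [τ.comp_two, τ.comp_two, hτsymm]
  trace_τ := by filter_upwards [e.open_target.mem_nhds hy] with z hz using hτtrace e he z hz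

end global

end Superint

end

theorem mainTheorem1 {M : Type*} [TopologicalSpace M] [ChartedSpace Plane M]
    [IsManifold 𝓘(ℝ, Plane) ∞ M]
    (g : TensorField M 2) (hg : g.IsMetric)
    (T : TensorField M 3)
    (hTsymm : ∀ x : M, ∀ u v w : TangentSpace 𝓘(ℝ, Plane) x,
      T.form x ![u, v, w] = T.form x ![v, u, w])
    (hTtrace : ∀ e ∈ charts M, ∀ y ∈ e.target, ∀ k : Fin 2,
      ∑ a, ∑ b, gInv (g.comp e) y a b * T.comp e y ![a, b, k] = 0)
    (τ : TensorField M 2)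
    (hτsymm : ∀ x : M, ∀ u v : TangentSpace 𝓘(ℝ, Plane) x, τ.form x ![u, v] = τ.form x ![v, u])
    (hτtrace : ∀ e ∈ charts M, ∀ y ∈ e.target,
      ∑ a, ∑ b, gInv (g.comp e) y a b * τ.comp e y ![a, b] = 0) :
    (∀ e ∈ charts M, ∀ y ∈ e.target,
      (∀ i j : Fin 2, τ.comp e y ![i, j] = rawTau (g.comp e) (T.comp e) y i j) ∧
      RicciV (g.comp e) (T.comp e) (τ.comp e) y ∧
      RicciC (g.comp e) (T.comp e) y)
    ↔
    (∃ S : TensorField M 3,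
      (∀ x : M, ∀ v : Fin 3 → TangentSpace 𝓘(ℝ, Plane) x, ∀ σ : Equiv.Perm (Fin 3),
        S.form x (fun a => v (σ a)) = S.form x v) ∧
      (∀ e ∈ charts M, ∀ y ∈ e.target, ∀ k : Fin 2,
        ∑ a, ∑ b, gInv (g.comp e) y a b * S.comp e y ![a, b, k] = 0) ∧
      (∀ x : M, ∃ U : Set M, IsOpen U ∧ x ∈ U ∧ ∃ t : M → ℝ,
        ContMDiffOn 𝓘(ℝ, Plane) 𝓘(ℝ, ℝ) ∞ t U ∧
        ∀ e ∈ charts M, ∀ y ∈ e.target, e.symm y ∈ U →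
          CondT (g.comp e) (T.comp e) (S.comp e) (diffl (t ∘ e.symm)) y ∧
          CondLap (g.comp e) (S.comp e) (diffl (t ∘ e.symm)) y ∧
          CondDS (g.comp e) (S.comp e) (diffl (t ∘ e.symm)) y ∧
          CondTau (g.comp e) (S.comp e) (diffl (t ∘ e.symm)) (τ.comp e) y ∧
          CondQ (g.comp e) (T.comp e) (τ.comp e) (diffl (t ∘ e.symm)) y ∧
          CondGamma (g.comp e) (T.comp e) (τ.comp e) (diffl (t ∘ e.symm)) y)) := by
  have H : ∀ e ∈ charts M, ∀ y ∈ e.target, TensorsAt (g.comp e) (T.comp e) (τ.comp e) y :=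
    fun e he y hy => tensorsAt hg hTsymm hTtrace hτsymm hτtrace he hy
  constructor
  · intro h
    have h' := fun e he y hy => (H e he y hy).integrability_iff.1 (h e he y hy)
    have hS : ∀ e ∈ charts M, ∀ y ∈ e.target, _ := fun e he y hy =>
      Spart_symm_trace (H e he y hy).metric.symm.self_of_nhds
        (H e he y hy).metric.det.self_of_nhds (H e he y hy).symm_T.self_of_nhds
        (H e he y hy).trace_T.self_of_nhds
    refine ⟨symField g hg T, fun x v σ => ?_, fun e he y hy k => ?_, fun x => ?_⟩
    · have he : chartAt Plane x ∈ charts M := IsManifold.chart_mem_maximalAtlas x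
      have hx := mem_chart_source Plane x
      have hy := (chartAt Plane x).map_source hx
      have := form_symm (A := symField g hg T) he hy (fun I σ => by
        rw [symField_comp hg T he hy]
        exact symm_of_adjacent (hS _ he _ hy).1 (hS _ he _ hy).2.1 I σ)
      rw [(chartAt Plane x).left_inv hx] at this
      exact this v σ
    · rw [symField_comp hg T he hy]
      exact (hS e he y hy).2.2 k
    · obtain ⟨U, hU, hxU, t, ht, hdt⟩ := exists_potential hg T
        (fun e he y hy => (h' e he y hy).1) x
      refine ⟨U, hU, hxU, t, ht, fun e he y hy hyU => ?_⟩
      have hnhds : ∀ᶠ z in nhds y, z ∈ e.target ∧ e.symm z ∈ U :=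
        (e.open_target.eventually_mem hy).and
          ((e.continuousAt_symm hy).eventually_mem (hU.mem_nhds hyU))
      obtain ⟨c1, c2⟩ := conditions_congr (g := g.comp e) (T := T.comp e) (τ := τ.comp e) (y := y)
        (S := (symField g hg T).comp e) (S' := Spart (g.comp e) (T.comp e))
        (dt := diffl (t ∘ e.symm)) (dt' := tForm (g.comp e) (T.comp e))
        (hnhds.mono fun z hz => symField_comp hg T he hz.1)
        (hnhds.mono fun z hz => hdt e he z hz.1 hz.2)
      exact ⟨c1.2 (condT_Spart (H e he y hy).metric.det.self_of_nhds), c2.2 (h' e he y hy).2⟩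
  · rintro ⟨S, hSsymm, hStrace, hloc⟩ e he y hy
    obtain ⟨U, hU, hxU, t, ht, hcond⟩ := hloc (e.symm y)
    have hnhds : ∀ᶠ z in nhds y, z ∈ e.target ∧ e.symm z ∈ U :=
      (e.open_target.eventually_mem hy).and
        ((e.continuousAt_symm hy).eventually_mem (hU.mem_nhds hxU))
    have hS' : ∀ z i j k, S.comp e z ![i, j, k] = S.comp e z ![i, k, j] := by
      intro z i j k
      rw [S.comp_three, S.comp_three, ← hSsymm _ _ (Equiv.swap 1 2)]
      congr 1
      ext1 a; fin_cases a <;> rfl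
    -- the decomposition of `T` is unique, so the given `S` and `dt` are those built from `T`
    have huniq : ∀ᶠ z in nhds y, S.comp e z = Spart (g.comp e) (T.comp e) z ∧
        diffl (t ∘ e.symm) z = tForm (g.comp e) (T.comp e) z := by
      filter_upwards [hnhds] with z hz
      have Hz := (H e he z hz.1).metric
      obtain ⟨u1, u2⟩ := condT_unique Hz.symm.self_of_nhds Hz.det.self_of_nhds (hS' z)
        (hStrace e he z hz.1) (hcond e he z hz.1 hz.2).1
      constructor
      · funext I
        have hI : I = ![I 0, I 1, I 2] := by ext a; fin_cases a <;> rfl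
        rw [hI, u2]
      · funext I
        have hI : I = ![I 0] := by ext a; fin_cases a; rfl
        rw [hI, u1]
    have hθ := huniq.mono fun z hz => hz.2
    have hsm : ContDiffAt ℝ ∞ (t ∘ e.symm) y :=
      ((ht.contMDiffAt (hU.mem_nhds hxU)).comp y
        ((contMDiffOn_symm_of_mem_maximalAtlas he).contMDiffAt
          (e.open_target.mem_nhds hy))).contDiffAt
    refine (H e he y hy).integrability_iff.2 ⟨fun k l => ?_, ?_⟩
    · rw [← cov_congr _ _ hθ]
      exact cov_diffl_symm (H e he y hy).metric.symm hsm k l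
    · exact (conditions_congr (T := T.comp e) (huniq.mono fun z hz => hz.1) hθ).2.1
        (hcond e he y hy hxU).2
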